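/- Consider $M\ge 1$ bosonic modes on Fock space with annihilation operators $a_1,\dots,a_M$, displacement operators $D(\vec\alpha)=\exp\sum_m(\alpha_m a_m^\dagger-\alpha_m^*a_m)$, parity $\Pi=\exp(-i\pi\sum_m a_m^\dagger a_m)$, and Wigner function $$W_\rho(\vec\alpha)=\Big(\frac{2}{\pi}\Big)^M\operatorname{tr}\big[\rho\,D(\vec\alpha)\,\Pi\,D(\vec\alpha)^\dagger\big].$$ The absolute Wigner volume of an $M$-mode state $\rho$ along the slice $\{\alpha\vec 1:\alpha\in\mathbb C\}$, $\vec 1=(1,\dots,1)$, is $$\mathcal V_{2D}(\rho;\mathbb C)=\Big(\frac{\pi}{2}\Big)^{M-1}\int_{\mathbb C}|W_\rho(\alpha\vec 1)|\,d^2\alpha\in[0,\infty].$$ Let $\mathcal U$ be a unitary $M\times M$ matrix with skew-Hermitian logarithm $\log\mathcal U$, and let $U_M=\exp\big(\sum_{i,j}(\log\mathcal U)_{ij}\,a_i^\dagger a_j\big)$ be the corresponding multiport beamsplitter. Suppose that for some complex numbers $c_{m,m'}$, $$\sqrt M\,U_M^\dagger a_mU_M=a_1+\sum_{m'\ne1}c_{m,m'}a_{m'}\qquad\text{for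 all }m$$ (as an identity on finite linear combinations of number states). For a one-mode state $\rho_1$ put $\mathcal U_M(\rho_1)=U_M\big(\rho_1\otimes(|0\rangle\langle0|)^{\otimes(M-1)}\big)U_M^\dagger$. Then the following hold. 1. For every one-mode state $\rho_1$, as an identity in $[0,\infty]$, $$\mathcal V_{2D}(\mathcal U_M(\rho_1);\mathbb C)=\frac1M\int_{\mathbb C}|W_{\rho_1}(\alpha)|\,d^2\alpha .$$ 2. $\mathcal U_M(|1\rangle\langle1|)=|W_M\rangle\langle W_M|$, where $|W_M\rangle=M^{-1/2}\big(|10\cdots0\rangle+|01\cdots0\rangle+\dots+|0\cdots01\rangle\big)$. Moreover, for every $M\ge 1$, $$\mathcal V_{2D}(|W_M\rangle\langle W_M|;\mathbb C)=\frac{4}{M\sqrt e}-\frac1M .$$ Consequently, for $M\ge2$, the state $|W_M\rangle$ is detected by the entanglement criterion $\mathcal V_{2D}(\rho;\mathbb C)>\frac{1}{2\sqrt{M-1}}$ along this slice if and only if $M\le6$. -/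

import Mathlib

open scoped ENNReal ComplexConjugate

noncomputable section

namespace BosonicModes

/-! ### Fock space of `M` bosonic modes -/

/-- The Hilbert space of `M` modes in the occupation-number representation, `ℓ²(ℕ^M)`. -/
abbrev Fock (M : ℕ) : Type := lp (fun _ : Fin M → ℕ => ℂ) 2

/-- The number state `|n₁, …, n_M⟩`. -/
def ket {M : ℕ} (n : Fin M → ℕ) : Fock M := lp.single 2 n (1 : ℂ)

/-- Finite linear combinations of number states (as formal combinations). -/
abbrev FinVec (M : ℕ) : Type := (Fin M → ℕ) →₀ ℂ

/-- A finite linear combination of number states, as a vector of the Hilbert space. -/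
def toFock {M : ℕ} : FinVec M →ₗ[ℂ] Fock M := Finsupp.linearCombination ℂ ket

/-- `a_m` on finite combinations of number states: `a_m |n⟩ = √n_m |n - 1_m⟩`. -/
def annFin {M : ℕ} (m : Fin M) : FinVec M →ₗ[ℂ] FinVec M :=
  Finsupp.linearCombination ℂ fun n =>
    Finsupp.single (n - Pi.single m 1) ((Real.sqrt (n m) : ℝ) : ℂ)

/-- `a_m†` on finite combinations of number states: `a_m† |n⟩ = √(n_m + 1) |n + 1_m⟩`. -/
def creFin {M : ℕ} (m : Fin M) : FinVec M →ₗ[ℂ] FinVec M :=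
  Finsupp.linearCombination ℂ fun n =>
    Finsupp.single (n + Pi.single m 1) ((Real.sqrt (n m + 1) : ℝ) : ℂ)

/-- The (unbounded) annihilation operator `a_m` on its maximal domain
`{ψ | ∑ n_m |ψ(n)|² < ∞}`, acting by `(a_m ψ)(n) = √(n_m + 1) ψ(n + 1_m)`. -/
def annihilation {M : ℕ} (m : Fin M) : Fock M →ₗ.[ℂ] Fock M where
  domain :=
    { carrier := {ψ | Memℓp (fun n : Fin M → ℕ =>
        ((Real.sqrt (n m + 1) : ℝ) : ℂ) * ψ (n + Pi.single m 1)) 2}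
      add_mem' := by
        intro ψ φ hψ hφ
        have h := Memℓp.add hψ hφ
        refine (congrArg (fun f => Memℓp f 2) ?_).mp h
        funext n
        simp [mul_add]
      zero_mem' := by
        have h := zero_memℓp (E := fun _ : Fin M → ℕ => ℂ) (p := 2)
        refine (congrArg (fun f => Memℓp f 2) ?_).mp h
        funext n
        simp
      smul_mem' := by
        intro c ψ hψ
        have h := Memℓp.const_smul hψ c
        refine (congrArg (fun f => Memℓp f 2) ?_).mp h
        funext n
        simp [mul_left_comm] }
  toFun :=
    { toFun := fun ψ => ⟨fun n : Fin M → ℕ =>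
        ((Real.sqrt (n m + 1) : ℝ) : ℂ) * ψ.1 (n + Pi.single m 1), ψ.2⟩
      map_add' := by
        intro ψ φ
        ext n
        exact mul_add _ _ _
      map_smul' := by
        intro c ψ
        ext n
        simp [mul_left_comm] }

/-! ### Exponentials of skew-symmetric operators on finite combinations of number states -/

lemma inner_ket {M : ℕ} (n n' : Fin M → ℕ) :
    inner ℂ (ket n) (ket n') = if n = n' then (1 : ℂ) else 0 := by
  classical
  unfold ket
  rw [lp.inner_single_left]
  by_cases h : n = n'
  · subst h; simp
  · simp [h, lp.single_apply]

lemma norm_ket {M : ℕ} (n : Fin M → ℕ) : ‖ket n‖ = 1 := by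
  have h : inner ℂ (ket n) (ket n) = (1 : ℂ) := by rw [inner_ket, if_pos rfl]
  have h2 : ‖ket n‖ ^ 2 = 1 := by rw [← inner_self_eq_norm_sq (𝕜 := ℂ), h]; simp
  nlinarith [norm_nonneg (ket n)]

lemma ket_orthonormal {M : ℕ} : Orthonormal ℂ (ket (M := M)) := by
  classical
  rw [orthonormal_iff_ite]
  intro n n'
  rw [inner_ket]

@[simp] lemma toFock_single {M : ℕ} (n : Fin M → ℕ) (c : ℂ) :
    toFock (Finsupp.single n c) = c • ket n := by
  simp [toFock]

@[simp] lemma annFin_single {M : ℕ} (m : Fin M) (n : Fin M → ℕ) :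
    annFin m (Finsupp.single n 1) =
      ((Real.sqrt (n m) : ℝ) : ℂ) • Finsupp.single (n - Pi.single m 1) 1 := by
  simp [annFin]

@[simp] lemma creFin_single {M : ℕ} (m : Fin M) (n : Fin M → ℕ) :
    creFin m (Finsupp.single n 1) =
      ((Real.sqrt (n m + 1) : ℝ) : ℂ) • Finsupp.single (n + Pi.single m 1) 1 := by
  simp [creFin]

/-- `X` is skew-symmetric and every number state is an analytic vector of infinite radius. -/
structure IsExpGenerator {M : ℕ} (X : FinVec M →ₗ[ℂ] FinVec M) : Prop where
  skew : ∀ f g, inner ℂ (toFock (X f)) (toFock g) = -inner ℂ (toFock f) (toFock (X g))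
  summable : ∀ n : Fin M → ℕ,
    Summable fun k : ℕ => ‖((k.factorial : ℂ)⁻¹) • toFock ((X ^ k) (Finsupp.single n 1))‖

/-- `e^X |n⟩ = ∑ₖ X^k |n⟩ / k!`. -/
def expKet {M : ℕ} (X : FinVec M →ₗ[ℂ] FinVec M) (n : Fin M → ℕ) : Fock M :=
  ∑' k : ℕ, ((k.factorial : ℂ)⁻¹) • toFock ((X ^ k) (Finsupp.single n 1))

lemma skew_pow {M : ℕ} {X : FinVec M →ₗ[ℂ] FinVec M}
    (skew : ∀ f g, inner ℂ (toFock (X f)) (toFock g) = -inner ℂ (toFock f) (toFock (X g)))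
    (j : ℕ) : ∀ f g, inner ℂ (toFock ((X ^ j) f)) (toFock g) =
      (-1) ^ j * inner ℂ (toFock f) (toFock ((X ^ j) g)) := by
  induction j with
  | zero => intro f g; simp
  | succ j ih =>
    intro f g
    rw [pow_succ', Module.End.mul_apply, skew, ih, ← Module.End.mul_apply, ← pow_succ, pow_succ']
    ring

lemma antidiagonal_sum (n : ℕ) :
    ∑ p ∈ Finset.HasAntidiagonal.antidiagonal n,
      ((p.1.factorial : ℂ)⁻¹) * ((p.2.factorial : ℂ)⁻¹) * (-1) ^ p.1 = if n = 0 then 1 else 0 := by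
  have h := (Commute.all (-1 : ℂ) 1).add_pow' n
  have e : ∀ p ∈ Finset.HasAntidiagonal.antidiagonal n,
      ((p.1.factorial : ℂ)⁻¹) * ((p.2.factorial : ℂ)⁻¹) * (-1) ^ p.1 =
      ((n.factorial : ℂ)⁻¹) * (n.choose p.1 • ((-1 : ℂ) ^ p.1 * 1 ^ p.2)) := by
    intro p hp
    rw [Finset.HasAntidiagonal.mem_antidiagonal] at hp
    have hc : ((n.choose p.1 : ℕ) : ℂ) * (p.1.factorial : ℂ) * (p.2.factorial : ℂ)
        = (n.factorial : ℂ) := by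
      have := Nat.add_choose_mul_factorial_mul_factorial p.1 p.2
      rw [← Nat.choose_symm_add, hp] at this
      exact_mod_cast this
    have h1 : (p.1.factorial : ℂ) ≠ 0 := by exact_mod_cast p.1.factorial_ne_zero
    have h2 : (p.2.factorial : ℂ) ≠ 0 := by exact_mod_cast p.2.factorial_ne_zero
    have h3 : (n.factorial : ℂ) ≠ 0 := by exact_mod_cast n.factorial_ne_zero
    rw [nsmul_eq_mul, one_pow, mul_one]
    field_simp
    rw [← hc]
    ring
  rw [Finset.sum_congr rfl e, ← Finset.mul_sum, ← h]
  by_cases h0 : n = 0 <;> simp [h0]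

lemma inner_expKet {M : ℕ} {X : FinVec M →ₗ[ℂ] FinVec M} (hX : IsExpGenerator X)
    (n n' : Fin M → ℕ) : inner ℂ (expKet X n) (expKet X n') = inner ℂ (ket n) (ket n') := by
  set x : ℕ → Fock M := fun k => ((k.factorial : ℂ)⁻¹) • toFock ((X ^ k) (Finsupp.single n 1))
    with hx
  set y : ℕ → Fock M := fun k => ((k.factorial : ℂ)⁻¹) • toFock ((X ^ k) (Finsupp.single n' 1))
    with hy
  have sx : Summable fun k => ‖x k‖ := hX.summable n
  have sy : Summable fun k => ‖y k‖ := hX.summable n'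
  have sF : Summable fun p : ℕ × ℕ => inner ℂ (x p.1) (y p.2) :=
    Summable.of_norm_bounded (sx.mul_of_nonneg sy (fun _ => norm_nonneg _)
      (fun _ => norm_nonneg _)) (fun p => norm_inner_le_norm _ _)
  have hL : inner ℂ (expKet X n) (expKet X n') = ∑' p : ℕ × ℕ, inner ℂ (x p.1) (y p.2) := by
    rw [sF.tsum_prod]
    have h1 : ∀ j, ∑' k, inner ℂ (x j) (y k) = inner ℂ (x j) (expKet X n') := fun j =>
      ((innerSL ℂ (x j)).hasSum sy.of_norm.hasSum).tsum_eq
    simp_rw [h1]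
    have h2 : HasSum (fun j => inner ℂ (expKet X n') (x j))
        (inner ℂ (expKet X n') (expKet X n)) :=
      (innerSL ℂ (expKet X n')).hasSum sx.of_norm.hasSum
    have h3 := (Complex.conjCLE : ℂ →L[ℝ] ℂ).hasSum h2
    have h4 := h3.tsum_eq
    simp only [ContinuousLinearEquiv.coe_coe, Complex.conjCLE_apply, inner_conj_symm] at h4
    exact h4.symm
  rw [hL, ← Finset.HasAntidiagonal.sigmaAntidiagonalEquivProd.tsum_eq]
  have sG : Summable fun c : (Σ N : ℕ, Finset.HasAntidiagonal.antidiagonal N) =>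
      inner ℂ (x (Finset.HasAntidiagonal.sigmaAntidiagonalEquivProd c).1)
        (y (Finset.HasAntidiagonal.sigmaAntidiagonalEquivProd c).2) :=
    Finset.HasAntidiagonal.sigmaAntidiagonalEquivProd.summable_iff.mpr sF
  rw [sG.tsum_sigma' (fun _ => (hasSum_fintype _).summable)]
  have hterm : ∀ N : ℕ, (∑' c : Finset.HasAntidiagonal.antidiagonal N,
      inner ℂ (x (Finset.HasAntidiagonal.sigmaAntidiagonalEquivProd ⟨N, c⟩).1)
        (y (Finset.HasAntidiagonal.sigmaAntidiagonalEquivProd ⟨N, c⟩).2)) =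
      if N = 0 then inner ℂ (ket n) (ket n') else (0 : ℂ) := by
    intro N
    rw [tsum_fintype]
    simp only [Finset.HasAntidiagonal.sigmaAntidiagonalEquivProd_apply]
    rw [Finset.sum_coe_sort (Finset.HasAntidiagonal.antidiagonal N) fun p : ℕ × ℕ => inner ℂ (x p.1) (y p.2)]
    have e : ∀ p ∈ Finset.HasAntidiagonal.antidiagonal N, inner ℂ (x p.1) (y p.2) =
        (((p.1.factorial : ℂ)⁻¹) * ((p.2.factorial : ℂ)⁻¹) * (-1) ^ p.1) *
          inner ℂ (toFock (Finsupp.single n 1)) (toFock ((X ^ N) (Finsupp.single n' 1))) := by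
      intro p hp
      rw [Finset.HasAntidiagonal.mem_antidiagonal] at hp
      simp only [hx, hy, inner_smul_left, inner_smul_right]
      rw [skew_pow hX.skew, ← Module.End.mul_apply, ← pow_add, hp]
      simp
      ring
    rw [Finset.sum_congr rfl e, ← Finset.sum_mul, antidiagonal_sum]
    by_cases h0 : N = 0 <;> simp [h0]
  simp_rw [hterm]
  rw [tsum_ite_eq]

lemma expKet_orthonormal {M : ℕ} {X : FinVec M →ₗ[ℂ] FinVec M} (hX : IsExpGenerator X) :
    Orthonormal ℂ (expKet X) := by
  classical
  rw [orthonormal_iff_ite]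
  intro n n'
  rw [inner_expKet hX, inner_ket]

/-- The operator `e^X` on the Hilbert space: the continuous extension of
`|n⟩ ↦ ∑ₖ X^k |n⟩ / k!`. -/
def expOp {M : ℕ} (X : FinVec M →ₗ[ℂ] FinVec M) (hX : IsExpGenerator X) :
    Fock M →L[ℂ] Fock M :=
  (expKet_orthonormal hX).orthogonalFamily.linearIsometry.toContinuousLinearMap

lemma expOp_ket {M : ℕ} (X : FinVec M →ₗ[ℂ] FinVec M) (hX : IsExpGenerator X)
    (n : Fin M → ℕ) : expOp X hX (ket n) = expKet X n := by
  classical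
  unfold expOp ket
  exact ((expKet_orthonormal hX).orthogonalFamily.linearIsometry_apply_single (1 : ℂ)).trans
    (by simp)

/-! ### Displacements, multiport beamsplitters and parity -/

/-- `∑_m (α_m a_m† - α_m^* a_m)`. -/
def displacementGen {M : ℕ} (α : Fin M → ℂ) : FinVec M →ₗ[ℂ] FinVec M :=
  ∑ m, (α m • creFin m - conj (α m) • annFin m)

/-- `∑_{i,j} L_{ij} a_i† a_j`. -/
def bilinearGen {M : ℕ} (L : Matrix (Fin M) (Fin M) ℂ) : FinVec M →ₗ[ℂ] FinVec M :=
  ∑ i, ∑ j, L i j • (creFin i ∘ₗ annFin j)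

lemma cre_adjoint_ann {M : ℕ} (m : Fin M) (f g : FinVec M) :
    inner ℂ (toFock (creFin m f)) (toFock g) = inner ℂ (toFock f) (toFock (annFin m g)) := by
  induction f using Finsupp.induction_linear with
  | zero => simp
  | add f₁ f₂ h₁ h₂ => simp only [map_add, inner_add_left, h₁, h₂]
  | single n c =>
    induction g using Finsupp.induction_linear with
    | zero => simp
    | add g₁ g₂ h₁ h₂ => simp only [map_add, inner_add_right, h₁, h₂]
    | single n' c' =>
      rw [← mul_one c, ← mul_one c', ← smul_eq_mul, ← smul_eq_mul, ← Finsupp.smul_single,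
        ← Finsupp.smul_single]
      simp only [map_smul, creFin_single, annFin_single, toFock_single, inner_smul_left,
        inner_smul_right, one_smul, inner_ket]
      by_cases h : n + Pi.single m 1 = n'
      · subst h
        have h2 : n + Pi.single m 1 - Pi.single m 1 = n := by
          funext i; simp
        simp [h2]
        left; ring
      · by_cases h3 : n' m = 0
        · simp [h3, h]
        · have h2 : n ≠ n' - Pi.single m 1 := by
            rintro rfl
            apply h
            funext i
            by_cases hi : i = m
            · subst hi; simp; omega
            · simp [hi]
          simp [h, h2]

lemma ann_adjoint_cre {M : ℕ} (m : Fin M) (f g : FinVec M) :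
    inner ℂ (toFock (annFin m f)) (toFock g) = inner ℂ (toFock f) (toFock (creFin m g)) := by
  rw [← inner_conj_symm, ← cre_adjoint_ann, inner_conj_symm]

lemma displacementGen_skew {M : ℕ} (α : Fin M → ℂ) (f g : FinVec M) :
    inner ℂ (toFock (displacementGen α f)) (toFock g) =
      -inner ℂ (toFock f) (toFock (displacementGen α g)) := by
  simp only [displacementGen, LinearMap.sum_apply, LinearMap.sub_apply, LinearMap.smul_apply,
    map_sum, map_sub, map_smul, sum_inner, inner_sum, inner_sub_left, inner_sub_right,
    inner_smul_left, inner_smul_right, cre_adjoint_ann, ann_adjoint_cre, Complex.conj_conj]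
  rw [← Finset.sum_neg_distrib]
  exact Finset.sum_congr rfl fun m _ => by ring

lemma bilinearGen_skew {M : ℕ} (L : Matrix (Fin M) (Fin M) ℂ) (hL : L.conjTranspose = -L)
    (f g : FinVec M) :
    inner ℂ (toFock (bilinearGen L f)) (toFock g) =
      -inner ℂ (toFock f) (toFock (bilinearGen L g)) := by
  simp only [bilinearGen, LinearMap.sum_apply, LinearMap.smul_apply, LinearMap.comp_apply,
    map_sum, map_smul, sum_inner, inner_sum, inner_smul_left, inner_smul_right,
    cre_adjoint_ann, ann_adjoint_cre]
  rw [Finset.sum_comm, ← Finset.sum_neg_distrib]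
  refine Finset.sum_congr rfl fun i _ => ?_
  rw [← Finset.sum_neg_distrib]
  refine Finset.sum_congr rfl fun j _ => ?_
  have h := congrFun (congrFun hL i) j
  simp only [Matrix.conjTranspose_apply, Matrix.neg_apply] at h
  rw [starRingEnd_apply, h]
  ring

lemma le_total {M : ℕ} (n : Fin M → ℕ) (m : Fin M) : n m ≤ ∑ i, n i :=
  Finset.single_le_sum (f := n) (fun _ _ => Nat.zero_le _) (Finset.mem_univ m)

lemma total_add {M : ℕ} (n : Fin M → ℕ) (m : Fin M) :
    ∑ i, (n + Pi.single m 1 : Fin M → ℕ) i = ∑ i, n i + 1 := by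
  simp [Finset.sum_add_distrib]

lemma total_sub {M : ℕ} (n : Fin M → ℕ) (m : Fin M) :
    ∑ i, (n - Pi.single m 1 : Fin M → ℕ) i ≤ ∑ i, n i :=
  Finset.sum_le_sum fun i _ => by simp

lemma displacementGen_bound {M : ℕ} (α : Fin M → ℂ) (k : ℕ) :
    ∀ (N : ℕ) (n : Fin M → ℕ), ∑ i, n i ≤ N →
      ‖toFock ((displacementGen α ^ k) (Finsupp.single n 1))‖ ≤
        (∑ m, 2 * ‖α m‖) ^ k * Real.sqrt ((N + 1).ascFactorial k) := by
  induction k with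
  | zero => intro N n _; simp [norm_ket]
  | succ k ih =>
    intro N n hn
    set C := ∑ m, 2 * ‖α m‖ with hC
    set B := C ^ k * Real.sqrt ((N + 1 + 1).ascFactorial k) with hB
    have hB0 : 0 ≤ B := by positivity
    rw [pow_succ, Module.End.mul_apply]
    simp only [displacementGen, LinearMap.sum_apply, LinearMap.sub_apply, LinearMap.smul_apply,
      creFin_single, annFin_single]
    rw [← displacementGen, map_sum, map_sum]
    have hs : Real.sqrt ((N + 1).ascFactorial (k + 1)) =
        Real.sqrt (N + 1) * Real.sqrt ((N + 1 + 1).ascFactorial k) := by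
      rw [← Real.sqrt_mul (by positivity)]
      congr 1
      have h := Nat.succ_ascFactorial (N + 1) k
      rw [Nat.ascFactorial_succ, ← h]
      push_cast
      ring
    have hgoal : C ^ (k + 1) * Real.sqrt ((N + 1).ascFactorial (k + 1)) =
        ∑ m, 2 * ‖α m‖ * (Real.sqrt (N + 1) * B) := by
      rw [← Finset.sum_mul, ← hC, hs, hB]; ring
    rw [hgoal]
    refine (norm_sum_le _ _).trans (Finset.sum_le_sum fun m _ => ?_)
    have hnm : (n m : ℝ) ≤ N := by exact_mod_cast (le_total n m).trans hn
    have h1 := ih (N + 1) (n + Pi.single m 1) (by rw [total_add]; omega)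
    have h2 := ih (N + 1) (n - Pi.single m 1) ((total_sub n m).trans (by omega))
    have s1 : Real.sqrt (n m + 1) ≤ Real.sqrt (N + 1) := Real.sqrt_le_sqrt (by linarith)
    have s2 : Real.sqrt (n m) ≤ Real.sqrt (N + 1) := Real.sqrt_le_sqrt (by linarith)
    simp only [map_sub, map_smul]
    refine (norm_sub_le _ _).trans ?_
    simp only [norm_smul, Complex.norm_real, Real.norm_eq_abs, abs_of_nonneg (Real.sqrt_nonneg _),
      RCLike.norm_conj]
    have t1 := mul_le_mul s1 h1 (norm_nonneg _) (Real.sqrt_nonneg _)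
    have t2 := mul_le_mul s2 h2 (norm_nonneg _) (Real.sqrt_nonneg _)
    have t3 := mul_le_mul_of_nonneg_left t1 (norm_nonneg (α m))
    have t4 := mul_le_mul_of_nonneg_left t2 (norm_nonneg (α m))
    calc _ ≤ ‖α m‖ * (Real.sqrt (N + 1) * B) + ‖α m‖ * (Real.sqrt (N + 1) * B) :=
          add_le_add t3 t4
      _ = _ := by ring

lemma bilinearGen_bound {M : ℕ} (L : Matrix (Fin M) (Fin M) ℂ) (N : ℕ) (k : ℕ) :
    ∀ n : Fin M → ℕ, ∑ i, n i ≤ N →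
      ‖toFock ((bilinearGen L ^ k) (Finsupp.single n 1))‖ ≤
        ((∑ i, ∑ j, ‖L i j‖) * (N + 1)) ^ k := by
  induction k with
  | zero => intro n _; simp [norm_ket]
  | succ k ih =>
    intro n hn
    set C := ∑ i, ∑ j, ‖L i j‖ with hC
    rw [pow_succ, Module.End.mul_apply]
    simp only [bilinearGen, LinearMap.sum_apply, LinearMap.smul_apply, LinearMap.comp_apply,
      annFin_single, map_smul, creFin_single]
    rw [← bilinearGen]
    simp only [map_sum, map_smul]
    have hgoal : (C * (N + 1)) ^ (k + 1) =
        ∑ i, ∑ j, ‖L i j‖ * ((N + 1) * (C * (N + 1)) ^ k) := by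
      simp_rw [← Finset.sum_mul]
      rw [← hC]; ring
    rw [hgoal]
    refine (norm_sum_le _ _).trans (Finset.sum_le_sum fun i _ => ?_)
    refine (norm_sum_le _ _).trans (Finset.sum_le_sum fun j _ => ?_)
    simp only [norm_smul, Complex.norm_real, Real.norm_eq_abs, abs_of_nonneg (Real.sqrt_nonneg _)]
    refine mul_le_mul_of_nonneg_left ?_ (norm_nonneg _)
    by_cases hj : n j = 0
    · simp only [hj, Nat.cast_zero, Real.sqrt_zero, zero_mul]
      positivity
    · have htot : ∑ l, (n - Pi.single j 1 + Pi.single i 1 : Fin M → ℕ) l ≤ N := by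
        rw [total_add]
        have hback : (n - Pi.single j 1) + Pi.single j 1 = n := by
          funext l
          by_cases hl : l = j
          · subst hl; simp; omega
          · simp [hl]
        have := total_add (n - Pi.single j 1) j
        rw [hback] at this
        omega
      have h1 := ih _ htot
      have hnj : (n j : ℝ) ≤ N := by exact_mod_cast (le_total n j).trans hn
      have hni : ((n - Pi.single j 1 : Fin M → ℕ) i : ℝ) ≤ N := by
        exact_mod_cast ((le_total _ i).trans (total_sub n j)).trans hn
      have s1 : Real.sqrt (n j) ≤ Real.sqrt (N + 1) := Real.sqrt_le_sqrt (by linarith)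
      have s2 : Real.sqrt ((n - Pi.single j 1 : Fin M → ℕ) i + 1) ≤ Real.sqrt (N + 1) :=
        Real.sqrt_le_sqrt (by linarith)
      have hN : Real.sqrt (N + 1) * Real.sqrt (N + 1) = N + 1 :=
        Real.mul_self_sqrt (by positivity)
      calc _ ≤ Real.sqrt (N + 1) * (Real.sqrt (N + 1) * (C * (N + 1)) ^ k) :=
            mul_le_mul s1 (mul_le_mul s2 h1 (norm_nonneg _) (Real.sqrt_nonneg _))
              (by positivity) (Real.sqrt_nonneg _)
        _ = _ := by rw [← mul_assoc, hN]

lemma summable_pow_div_sqrt_factorial (x : ℝ) :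
    Summable fun k : ℕ => x ^ k / Real.sqrt k.factorial := by
  have h1 : Summable fun k : ℕ => (4 * x ^ 2) ^ k / (k.factorial : ℝ) :=
    Real.summable_pow_div_factorial _
  have h2 : Summable fun k : ℕ => ((1 : ℝ) / 4) ^ k :=
    summable_geometric_of_lt_one (by norm_num) (by norm_num)
  refine Summable.of_norm_bounded (h1.add h2) fun k => ?_
  have hf : (0 : ℝ) < k.factorial := by exact_mod_cast k.factorial_pos
  set s := Real.sqrt k.factorial with hs
  have hs0 : 0 < s := Real.sqrt_pos.mpr hf
  have hss : s ^ 2 = k.factorial := Real.sq_sqrt hf.le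
  set u := (2 * |x|) ^ k / s with hu
  set v := ((1 : ℝ) / 2) ^ k with hv
  have e1 : ‖x ^ k / s‖ = u * v := by
    rw [norm_div, norm_pow, Real.norm_eq_abs, Real.norm_eq_abs, abs_of_pos hs0, hu, hv,
      div_mul_eq_mul_div, ← mul_pow]
    congr 2; ring
  have e2 : (4 * x ^ 2) ^ k / (k.factorial : ℝ) = u ^ 2 := by
    have : (2 * |x|) ^ 2 = 4 * x ^ 2 := by rw [mul_pow, sq_abs]; norm_num
    rw [hu, div_pow, hss, ← pow_mul, mul_comm k 2, pow_mul, this]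
  have e3 : ((1 : ℝ) / 4) ^ k = v ^ 2 := by
    rw [hv, ← pow_mul, mul_comm k 2, pow_mul]; norm_num
  rw [e1, e2, e3]
  nlinarith [sq_nonneg (u - v), sq_nonneg (u + v)]

lemma isExpGenerator_displacementGen {M : ℕ} (α : Fin M → ℂ) :
    IsExpGenerator (displacementGen α) where
  skew := displacementGen_skew α
  summable := by
    intro n
    set N := ∑ i, n i with hN
    set C := ∑ m, 2 * ‖α m‖ with hC
    have hC0 : 0 ≤ C := by positivity
    refine Summable.of_nonneg_of_le (fun _ => norm_nonneg _) (fun k => ?_)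
      ((summable_pow_div_sqrt_factorial (Real.sqrt 2 * C)).mul_left (Real.sqrt 2 ^ N))
    have h := displacementGen_bound α k N n le_rfl
    have hf : (0 : ℝ) < k.factorial := by exact_mod_cast k.factorial_pos
    have hasc : ((N + 1).ascFactorial k : ℝ) ≤ 2 ^ (N + k) * k.factorial := by
      have h1 := Nat.ascFactorial_eq_factorial_mul_choose N k
      have h2 : (N + k).choose k ≤ 2 ^ (N + k) := Nat.choose_le_two_pow _ _
      have h3 : (N + 1).ascFactorial k ≤ 2 ^ (N + k) * k.factorial := by
        rw [h1, mul_comm]; exact Nat.mul_le_mul_right _ h2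
      exact_mod_cast h3
    have hsq : Real.sqrt ((N + 1).ascFactorial k) ≤
        Real.sqrt 2 ^ (N + k) * Real.sqrt k.factorial := by
      refine (Real.sqrt_le_sqrt hasc).trans (le_of_eq ?_)
      rw [Real.sqrt_mul (by positivity)]
      congr 1
      rw [Real.sqrt_eq_iff_mul_self_eq (by positivity) (by positivity), ← mul_pow]
      norm_num
    have hs0 : 0 < Real.sqrt k.factorial := Real.sqrt_pos.mpr hf
    have hss : Real.sqrt k.factorial * Real.sqrt k.factorial = k.factorial :=
      Real.mul_self_sqrt hf.le
    rw [norm_smul, norm_inv, Complex.norm_natCast]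
    calc _ ≤ (k.factorial : ℝ)⁻¹ * (C ^ k * (Real.sqrt 2 ^ (N + k) * Real.sqrt k.factorial)) := by
          gcongr
          exact h.trans (by gcongr)
      _ = _ := by
          have hi : (k.factorial : ℝ)⁻¹ * Real.sqrt k.factorial = (Real.sqrt k.factorial)⁻¹ := by
            apply eq_inv_of_mul_eq_one_left
            rw [mul_assoc, hss, inv_mul_cancel₀ hf.ne']
          rw [div_eq_mul_inv, ← hi, pow_add, mul_pow]
          ring

lemma isExpGenerator_bilinearGen {M : ℕ} (L : Matrix (Fin M) (Fin M) ℂ)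
    (hL : L.conjTranspose = -L) : IsExpGenerator (bilinearGen L) where
  skew := bilinearGen_skew L hL
  summable := by
    intro n
    refine Summable.of_nonneg_of_le (fun _ => norm_nonneg _) (fun k => ?_)
      (Real.summable_pow_div_factorial ((∑ i, ∑ j, ‖L i j‖) * ((∑ i, n i : ℕ) + 1)))
    rw [norm_smul, norm_inv, Complex.norm_natCast, inv_mul_eq_div]
    gcongr
    exact bilinearGen_bound L _ k n le_rfl

/-- The displacement operator `D(α) = exp(∑_m (α_m a_m† - α_m^* a_m))`. -/
def displacement {M : ℕ} (α : Fin M → ℂ) : Fock M →L[ℂ] Fock M :=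
  expOp (displacementGen α) (isExpGenerator_displacementGen α)

/-- The operator `exp(∑_{i,j} L_{ij} a_i† a_j)` for a skew-Hermitian matrix `L`. -/
def bilinearExp {M : ℕ} (L : Matrix (Fin M) (Fin M) ℂ) (hL : L.conjTranspose = -L) :
    Fock M →L[ℂ] Fock M :=
  expOp (bilinearGen L) (isExpGenerator_bilinearGen L hL)

/-- `U` is the multiport beamsplitter `exp(a† (log 𝒰) a)` of the unitary matrix `𝒰`, where
`log 𝒰` is a skew-Hermitian logarithm of `𝒰`. -/
def IsMultiportBeamsplitter {M : ℕ} (𝒰 : Matrix.unitaryGroup (Fin M) ℂ)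
    (U : Fock M →L[ℂ] Fock M) : Prop :=
  ∃ (L : Matrix (Fin M) (Fin M) ℂ) (hL : L.conjTranspose = -L),
    NormedSpace.exp L = (𝒰 : Matrix (Fin M) (Fin M) ℂ) ∧ U = bilinearExp L hL

/-- The matrix `-iπ·1`. -/
def parityMatrix (M : ℕ) : Matrix (Fin M) (Fin M) ℂ := (-(Complex.I * Real.pi)) • 1

lemma parityMatrix_skew (M : ℕ) : (parityMatrix M).conjTranspose = -parityMatrix M := by
  simp [parityMatrix, Matrix.conjTranspose_smul]

/-- The total parity operator `Π = exp(-iπ ∑_m a_m† a_m)`. -/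
def parity (M : ℕ) : Fock M →L[ℂ] Fock M := bilinearExp (parityMatrix M) (parityMatrix_skew M)

/-! ### States, Wigner function and absolute Wigner volume -/

/-- The trace `∑_n ⟨n|T|n⟩` of a (trace-class) operator. -/
def trace {M : ℕ} (T : Fock M →L[ℂ] Fock M) : ℂ := ∑' n, inner ℂ (ket n) (T (ket n))

/-- Density operators: positive operators with (convergent) trace `1`. -/
def IsState {M : ℕ} (ρ : Fock M →L[ℂ] Fock M) : Prop :=
  ρ.IsPositive ∧ HasSum (fun n => inner ℂ (ket n) (ρ (ket n))) 1

/-- The displaced parity operator `Π(α) = D(α) Π D(α)†`. -/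
def displacedParity {M : ℕ} (α : Fin M → ℂ) : Fock M →L[ℂ] Fock M :=
  displacement α ∘L parity M ∘L ContinuousLinearMap.adjoint (displacement α)

/-- The Wigner function `W_ρ(α) = (2/π)^M tr[ρ Π(α)]`. -/
def wigner {M : ℕ} (ρ : Fock M →L[ℂ] Fock M) (α : Fin M → ℂ) : ℂ :=
  ((2 / Real.pi : ℝ) : ℂ) ^ M * trace (ρ ∘L displacedParity α)

/-- The absolute Wigner volume
`𝒱(ρ; ω) = (π/2)^(M-1) ∫_ω |W_ρ(α y + α^* z)| d²α ∈ [0, ∞]`. -/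
def absVolume {M : ℕ} (y z : Fin M → ℂ) (ρ : Fock M →L[ℂ] Fock M) (ω : Set ℂ) : ℝ≥0∞ :=
  ENNReal.ofReal ((Real.pi / 2) ^ (M - 1)) *
    ∫⁻ α in ω, ‖wigner ρ (fun m => α * y m + conj α * z m)‖ₑ

/-- The absolute Wigner volume along the slice `{α (1, …, 1) : α ∈ ℂ}`. -/
def diagVolume {M : ℕ} (ρ : Fock M →L[ℂ] Fock M) : ℝ≥0∞ :=
  absVolume (fun _ => 1) (fun _ => 0) ρ Set.univ

/-! ### Interference with vacua -/

lemma vacuum_kets_orthonormal (M : ℕ) [NeZero M] :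
    Orthonormal ℂ fun n : Fin 1 → ℕ => ket (Pi.single (0 : Fin M) (n 0)) := by
  refine ket_orthonormal.comp _ fun n n' h => ?_
  funext i
  rw [Subsingleton.elim i 0]
  exact Pi.single_injective (0 : Fin M) h

/-- The isometry `ψ ↦ ψ ⊗ |0⟩^{⊗(M-1)}`, where `ψ` sits in the first mode. -/
def tensorVacuum (M : ℕ) [NeZero M] : Fock 1 →L[ℂ] Fock M :=
  (vacuum_kets_orthonormal M).orthogonalFamily.linearIsometry.toContinuousLinearMap

/-- `ρ₁ ⊗ (|0⟩⟨0|)^{⊗(M-1)} = J ρ₁ J†` with `J ψ = ψ ⊗ |0⟩^{⊗(M-1)}`. -/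
def withVacua (M : ℕ) [NeZero M] (ρ₁ : Fock 1 →L[ℂ] Fock 1) : Fock M →L[ℂ] Fock M :=
  tensorVacuum M ∘L ρ₁ ∘L ContinuousLinearMap.adjoint (tensorVacuum M)

/-- `U (ρ₁ ⊗ (|0⟩⟨0|)^{⊗(M-1)}) U†`. -/
def interfere {M : ℕ} [NeZero M] (U : Fock M →L[ℂ] Fock M) (ρ₁ : Fock 1 →L[ℂ] Fock 1) :
    Fock M →L[ℂ] Fock M :=
  U ∘L withVacua M ρ₁ ∘L ContinuousLinearMap.adjoint U

/-- The rank-one operator `|ψ⟩⟨ψ|`. -/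
def pureState {M : ℕ} (ψ : Fock M) : Fock M →L[ℂ] Fock M := InnerProductSpace.rankOne ℂ ψ ψ

/-- The `W` state `(|10…0⟩ + |01…0⟩ + ⋯ + |00…1⟩)/√M`. -/
def wState (M : ℕ) : Fock M :=
  (((Real.sqrt M : ℝ) : ℂ)⁻¹) • ∑ m : Fin M, ket (Pi.single m 1)

/-- `U` is balanced with respect to the first mode: for every `m`, on finite combinations of
number states, `√M U† a_m U = a_1 + ∑_{m' ≠ 1} c_{m,m'} a_{m'}`. -/
def IsBalanced {M : ℕ} [NeZero M] (U : Fock M →L[ℂ] Fock M) (c : Fin M → Fin M → ℂ) : Prop :=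
  ∀ (m : Fin M) (f : FinVec M), ∃ h : U (toFock f) ∈ (annihilation m).domain,
    ((Real.sqrt M : ℝ) : ℂ) • ContinuousLinearMap.adjoint U (annihilation m ⟨U (toFock f), h⟩) =
      toFock (annFin 0 f) + ∑ m' ∈ Finset.univ.erase 0, c m m' • toFock (annFin m' f)

end BosonicModes

end

open BosonicModes

namespace BosonicModes

/-! ### The number-state basis -/

/-! Everything is computed on exponential vectors (unnormalized coherent states) `expVec β`. Each
operator involved sends such a vector to a scalar multiple of another: a displacement translates β,
a bilinear exponential applies the matrix e^L to β, parity negates β. Hence D(α)ΠD(α)† reflects β to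
2α − β, up to an explicit exponential factor (`displacedParity_expVec`). The formulas rest on
`expOp_apply_flow`: the expected image, deformed by a complex time s, solves Ψ' = XΨ weakly and is
entire in s, so its Taylor series at 0 is the series defining e^X.

Balance enters only through the matrix element ⟨0|U†a_mU|1,0,…,0⟩, which makes the first column of
e^L constantly 1/√M (`IsBalanced.exp_apply_zero`). So the isometry V = U(· ⊗ vacuum) spreads the
amplitude b as b/√M over all modes, and reflecting through the diagonal point α(1,…,1) replaces b by
2√Mα − b. Since one-mode exponential vectors are total, V† intertwines diagonal displaced parity at
α with one-mode displaced parity at √Mα. Cyclicity of the trace (`trace_conj_comp`) turns this into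
W(α,…,α) = (2/π)^(M−1) W_ρ(√Mα), and a change of variables in the plane leaves the factor 1/M.

The same column condition makes U|1,0,…,0⟩ the W state. As a balanced unitary exists for every M
(`exists_balanced_log`), the W volume is 1/M times the absolute Wigner integral of one photon, a
radial integral equal to K = 4/√e − 1. The criterion becomes M² < 4K²(M − 1), which is settled
numerically. -/

lemma inner_ket_left {M : ℕ} (n : Fin M → ℕ) (ψ : Fock M) : inner ℂ (ket n) ψ = ψ n := by
  unfold ket
  rw [lp.inner_single_left]
  simp

lemma ket_apply {M : ℕ} (n k : Fin M → ℕ) : (ket n : Fock M) k = if k = n then 1 else 0 := by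
  rw [← inner_ket_left, inner_ket]

lemma hasSum_ket {M : ℕ} (ψ : Fock M) : HasSum (fun n => ψ n • ket n) ψ := by
  classical
  refine (lp.hasSum_single (p := 2) (by simp) ψ).congr_fun ?_
  intro n
  ext k
  by_cases h : k = n
  · subst h; simp [ket]
  · simp [ket, h]

lemma ext_ket {M : ℕ} {E : Type*} [NormedAddCommGroup E] [NormedSpace ℂ E]
    {A B : Fock M →L[ℂ] E} (h : ∀ n, A (ket n) = B (ket n)) : A = B := by
  ext1 ψ
  have hA := A.hasSum (hasSum_ket ψ)
  have hB := B.hasSum (hasSum_ket ψ)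
  simp only [map_smul, h] at hA hB
  exact hA.unique hB

/-- Parseval's identity for the number states. -/
lemma hasSum_inner_ket {M : ℕ} (ψ φ : Fock M) :
    HasSum (fun n => inner ℂ ψ (ket n) * inner ℂ (ket n) φ) (inner ℂ ψ φ) := by
  have h := (innerSL ℂ ψ).hasSum (hasSum_ket φ)
  simp only [innerSL_apply_apply, inner_smul_right] at h
  refine h.congr_fun fun n => ?_
  rw [inner_ket_left, mul_comm]

lemma hasSum_norm_inner_ket {M : ℕ} (ψ : Fock M) :
    HasSum (fun n => ‖inner ℂ (ket n) ψ‖ ^ 2) (‖ψ‖ ^ 2) := by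
  have h := Complex.reCLM.hasSum (hasSum_inner_ket ψ ψ)
  have e : Complex.reCLM (inner ℂ ψ ψ) = ‖ψ‖ ^ 2 := by
    rw [inner_self_eq_norm_sq_to_K]; simp [← Complex.ofReal_pow]
  rw [e] at h
  refine h.congr_fun fun n => ?_
  rw [← inner_conj_symm ψ (ket n), ← Complex.normSq_eq_conj_mul_self, Complex.normSq_eq_norm_sq]
  exact (Complex.ofReal_re _).symm

/-! ### Exponentials of skew-symmetric operators -/

lemma neg_pow_apply {M : ℕ} (X : FinVec M →ₗ[ℂ] FinVec M) (k : ℕ) (f : FinVec M) :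
    ((-X) ^ k) f = (-1 : ℂ) ^ k • (X ^ k) f := by
  induction k with
  | zero => simp
  | succ k ih =>
    rw [pow_succ', Module.End.mul_apply, ih, pow_succ' X, Module.End.mul_apply, LinearMap.neg_apply,
      map_smul, pow_succ', neg_one_mul, neg_smul]

lemma IsExpGenerator.neg {M : ℕ} {X : FinVec M →ₗ[ℂ] FinVec M} (hX : IsExpGenerator X) :
    IsExpGenerator (-X) where
  skew f g := by simp [hX.skew]
  summable n := by
    refine (hX.summable n).congr fun k => ?_
    simp [neg_pow_apply, norm_smul]

lemma hasSum_expKet {M : ℕ} {X : FinVec M →ₗ[ℂ] FinVec M} (hX : IsExpGenerator X)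
    (n : Fin M → ℕ) :
    HasSum (fun k : ℕ => ((k.factorial : ℂ)⁻¹) • toFock ((X ^ k) (Finsupp.single n 1)))
      (expKet X n) :=
  (hX.summable n).of_norm.hasSum

lemma hasSum_inner_expKet_left {M : ℕ} {X : FinVec M →ₗ[ℂ] FinVec M} (hX : IsExpGenerator X)
    (n : Fin M → ℕ) (ψ : Fock M) :
    HasSum (fun k : ℕ => ((k.factorial : ℂ)⁻¹) * inner ℂ (toFock ((X ^ k) (Finsupp.single n 1))) ψ)
      (inner ℂ (expKet X n) ψ) := by
  have h := (innerSLFlip ℂ ψ).hasSum (hasSum_expKet hX n)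
  simpa [inner_smul_left] using h

/-- Skew-symmetry moves X^k across the inner product with sign (−1)^k, so the two exponential series
have the same matrix elements term by term. -/
lemma adjoint_expOp {M : ℕ} {X : FinVec M →ₗ[ℂ] FinVec M} (hX : IsExpGenerator X) :
    ContinuousLinearMap.adjoint (expOp X hX) = expOp (-X) hX.neg := by
  refine ext_ket fun n => ?_
  ext k
  rw [← inner_ket_left, ← inner_ket_left, ContinuousLinearMap.adjoint_inner_right, expOp_ket,
    expOp_ket]
  have h1 := hasSum_inner_expKet_left hX k (ket n)
  have h2 := (innerSL ℂ (ket k)).hasSum (hasSum_expKet hX.neg n)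
  simp only [innerSL_apply_apply, inner_smul_right] at h2
  refine h1.unique (h2.congr_fun fun j => ?_)
  have h3 := skew_pow hX.skew j (Finsupp.single k 1) (Finsupp.single n 1)
  rw [toFock_single n, toFock_single k, one_smul, one_smul] at h3
  rw [h3, neg_pow_apply, map_smul, inner_smul_right]

/-- `expOp` is an isometry by construction; this half of unitarity, U†U = 1, suffices below. -/
lemma adjoint_expOp_apply_self {M : ℕ} {X : FinVec M →ₗ[ℂ] FinVec M} (hX : IsExpGenerator X)
    (ψ : Fock M) : ContinuousLinearMap.adjoint (expOp X hX) (expOp X hX ψ) = ψ := by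
  have h : ContinuousLinearMap.adjoint (expOp X hX) ∘L expOp X hX = 1 :=
    (ContinuousLinearMap.norm_map_iff_adjoint_comp_self _).mp
      (expKet_orthonormal hX).orthogonalFamily.linearIsometry.norm_map
  exact congrArg (fun T : Fock M →L[ℂ] Fock M => T ψ) h

/-- `e^X` maps `Ψ 0` to `Ψ 1` along any weak solution of `Ψ' = X Ψ` on the complex line. -/
lemma expOp_apply_flow {M : ℕ} {X : FinVec M →ₗ[ℂ] FinVec M} (hX : IsExpGenerator X)
    (Ψ : ℂ → Fock M)
    (hΨ : ∀ f s, HasDerivAt (fun s => inner ℂ (toFock f) (Ψ s))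
      (-inner ℂ (toFock (X f)) (Ψ s)) s) :
    expOp X hX (Ψ 0) = Ψ 1 := by
  ext n
  rw [← inner_ket_left, ← inner_ket_left, ← ContinuousLinearMap.adjoint_inner_left,
    adjoint_expOp, expOp_ket]
  -- Applying `hΨ` repeatedly moves every derivative onto the finite vector, so Ψ itself never has
  -- to lie in a domain of X.
  have hd : ∀ k : ℕ, ∀ f : FinVec M, iteratedDeriv k (fun s => inner ℂ (toFock f) (Ψ s)) =
      fun s => inner ℂ (toFock (((-X) ^ k) f)) (Ψ s) := by
    intro k
    induction k with
    | zero => intro f; simp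
    | succ k ih =>
      intro f
      rw [iteratedDeriv_succ, ih]
      funext s
      rw [(hΨ _ s).deriv, pow_succ', Module.End.mul_apply]
      simp
  -- Complex differentiability everywhere makes the Taylor series at 0 converge at s = 1; this is
  -- why the flow has complex time.
  have hent : Differentiable ℂ (fun s => inner ℂ (toFock (Finsupp.single n 1)) (Ψ s)) :=
    fun s => (hΨ _ s).differentiableAt
  have h1 := Complex.hasSum_taylorSeries_of_entire hent 0 1
  have h2 := hasSum_inner_expKet_left hX.neg n (Ψ 0)
  rw [toFock_single, one_smul] at h1
  refine h2.unique (h1.congr_fun fun k => ?_)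
  have h3 := congrFun (hd k (Finsupp.single n 1)) 0
  rw [toFock_single, one_smul] at h3
  rw [h3]
  simp

/-! ### Exponential vectors -/

/-- Any finite set of multi-indices lies in a box, where the sum factors into one-variable sums. -/
lemma summable_prod_pi {M : ℕ} {g : Fin M → ℕ → ℝ} (h0 : ∀ m k, 0 ≤ g m k)
    (hg : ∀ m, Summable (g m)) : Summable fun n : Fin M → ℕ => ∏ m, g m (n m) := by
  classical
  refine summable_of_sum_le (c := ∏ m, ∑' k, g m k)
    (fun n => Finset.prod_nonneg fun m _ => h0 _ _) fun s => ?_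
  have hs : s ⊆ Fintype.piFinset fun m => s.image fun n => n m := fun n hn => by
    rw [Fintype.mem_piFinset]
    exact fun m => Finset.mem_image_of_mem _ hn
  calc _ ≤ ∑ n ∈ Fintype.piFinset fun m => s.image fun n => n m, ∏ m, g m (n m) :=
        Finset.sum_le_sum_of_subset_of_nonneg hs fun n _ _ =>
          Finset.prod_nonneg fun m _ => h0 _ _
    _ = ∏ m, ∑ k ∈ s.image fun n => n m, g m k := (Finset.prod_univ_sum _ _).symm
    _ ≤ _ := Finset.prod_le_prod (fun m _ => Finset.sum_nonneg fun k _ => h0 _ _)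
        fun m _ => (hg m).sum_le_tsum _ fun k _ => h0 _ _

lemma memℓp_expVec {M : ℕ} (β : Fin M → ℂ) :
    Memℓp (fun n : Fin M → ℕ => ∏ m, β m ^ n m / ((Real.sqrt (n m).factorial : ℝ) : ℂ)) 2 := by
  refine memℓp_gen ?_
  refine (summable_prod_pi (g := fun m k => (‖β m‖ ^ 2) ^ k / (k.factorial : ℝ))
    (fun m k => by positivity) fun m => Real.summable_pow_div_factorial _).congr fun n => ?_
  simp only [norm_prod, ENNReal.toReal_ofNat, Real.rpow_ofNat, ← Finset.prod_pow]
  refine Finset.prod_congr rfl fun m _ => ?_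
  rw [norm_div, div_pow, norm_pow, Complex.norm_real, Real.norm_eq_abs, sq_abs,
    Real.sq_sqrt (by positivity), ← pow_mul, ← pow_mul, mul_comm]

/-- The exponential vector `∑ₙ (βⁿ / √n!) |n⟩`, an unnormalized coherent state. -/
noncomputable def expVec {M : ℕ} (β : Fin M → ℂ) : Fock M :=
  ⟨fun n => ∏ m, β m ^ n m / ((Real.sqrt (n m).factorial : ℝ) : ℂ), memℓp_expVec β⟩

lemma expVec_apply {M : ℕ} (β : Fin M → ℂ) (n : Fin M → ℕ) :
    expVec β n = ∏ m, β m ^ n m / ((Real.sqrt (n m).factorial : ℝ) : ℂ) := rfl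

/-- The coefficient identity behind the eigenvalue equation a e(b) = b e(b). -/
lemma sqrt_mul_pow_succ_div (b : ℂ) (k : ℕ) :
    ((Real.sqrt (k + 1) : ℝ) : ℂ) * (b ^ (k + 1) / ((Real.sqrt (k + 1).factorial : ℝ) : ℂ)) =
      b * (b ^ k / ((Real.sqrt k.factorial : ℝ) : ℂ)) := by
  have h1 : ((Real.sqrt (k + 1) : ℝ) : ℂ) ≠ 0 := by
    exact_mod_cast (Real.sqrt_pos.mpr (by positivity)).ne'
  have h2 : ((Real.sqrt k.factorial : ℝ) : ℂ) ≠ 0 := by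
    exact_mod_cast (Real.sqrt_pos.mpr (by positivity)).ne'
  rw [Nat.factorial_succ, Nat.cast_mul, Real.sqrt_mul (by positivity)]
  push_cast
  field_simp
  ring

/-- Weak form of a_m e(β) = β_m e(β): the adjoint acts on the finite vector, which avoids domain
questions. -/
lemma inner_creFin_expVec {M : ℕ} (β : Fin M → ℂ) (m : Fin M) (f : FinVec M) :
    inner ℂ (toFock (creFin m f)) (expVec β) = β m * inner ℂ (toFock f) (expVec β) := by
  induction f using Finsupp.induction_linear with
  | zero => simp
  | add f g hf hg => simp only [map_add, inner_add_left, hf, hg, mul_add]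
  | single n c =>
    rw [← mul_one c, ← smul_eq_mul, ← Finsupp.smul_single]
    simp only [map_smul, creFin_single, toFock_single, inner_smul_left, one_smul, inner_ket_left,
      expVec_apply, Complex.conj_ofReal]
    rw [← Finset.mul_prod_erase _ _ (Finset.mem_univ m),
      ← Finset.mul_prod_erase _ (fun i => β i ^ n i / _) (Finset.mem_univ m),
      Finset.prod_congr rfl (g := fun i => β i ^ n i / ((Real.sqrt (n i).factorial : ℝ) : ℂ))]
    · have h := sqrt_mul_pow_succ_div (β m) (n m)
      simp only [Pi.add_apply, Pi.single_eq_same]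
      linear_combination (conj c * ∏ i ∈ Finset.univ.erase m,
        (β i ^ n i / ((Real.sqrt (n i).factorial : ℝ) : ℂ))) * h
    · intro i hi
      simp [Pi.single_eq_of_ne (Finset.ne_of_mem_erase hi)]

/-- Weak form of d/ds e(γ) = ∑ γ'_m a_m† e(γ). -/
lemma hasDerivAt_inner_expVec {M : ℕ} {γ : ℂ → Fin M → ℂ} {γ' : Fin M → ℂ} {s : ℂ}
    (hγ : ∀ m, HasDerivAt (fun s => γ s m) (γ' m) s) (f : FinVec M) :
    HasDerivAt (fun s => inner ℂ (toFock f) (expVec (γ s)))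
      (∑ m, γ' m * inner ℂ (toFock (annFin m f)) (expVec (γ s))) s := by
  induction f using Finsupp.induction_linear with
  | zero => simpa using hasDerivAt_const s (0 : ℂ)
  | add f g hf hg =>
    simp only [map_add, inner_add_left, mul_add, Finset.sum_add_distrib]
    exact hf.add hg
  | single n c =>
    rw [← mul_one c, ← smul_eq_mul, ← Finsupp.smul_single]
    simp only [map_smul, annFin_single, toFock_single, inner_smul_left, one_smul, inner_ket_left,
      expVec_apply, Complex.conj_ofReal]
    have h := (HasDerivAt.fun_finsetProd (u := Finset.univ)
      (f := fun m s => γ s m ^ n m / ((Real.sqrt (n m).factorial : ℝ) : ℂ))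
      fun m _ => ((hγ m).fun_pow (n m)).div_const _).const_mul (conj c)
    refine h.congr_deriv ?_
    rw [Finset.mul_sum]
    refine Finset.sum_congr rfl fun m _ => ?_
    have hsplit : ∀ k : Fin M → ℕ,
        ∏ i, γ s i ^ k i / ((Real.sqrt (k i).factorial : ℝ) : ℂ) =
        γ s m ^ k m / ((Real.sqrt (k m).factorial : ℝ) : ℂ) *
          ∏ i ∈ Finset.univ.erase m, γ s i ^ k i / ((Real.sqrt (k i).factorial : ℝ) : ℂ) :=
      fun k => (Finset.mul_prod_erase _ _ (Finset.mem_univ m)).symm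
    have herase : ∏ i ∈ Finset.univ.erase m, γ s i ^ (n - Pi.single m 1 : Fin M → ℕ) i /
          ((Real.sqrt ((n - Pi.single m 1 : Fin M → ℕ) i).factorial : ℝ) : ℂ) =
        ∏ i ∈ Finset.univ.erase m, γ s i ^ n i / ((Real.sqrt (n i).factorial : ℝ) : ℂ) :=
      Finset.prod_congr rfl fun i hi => by
        simp [Pi.single_eq_of_ne (Finset.ne_of_mem_erase hi)]
    rw [hsplit, herase]
    simp only [Pi.sub_apply, Pi.single_eq_same, smul_eq_mul]
    -- For n m = 0 the truncated subtraction is harmless: the derivative of the constant power and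
    -- the factor √0 both vanish.
    rcases hn : n m with _ | k
    · simp
    · have h := sqrt_mul_pow_succ_div 1 k
      simp only [one_pow, one_mul] at h
      have h2 : ((Real.sqrt ((k + 1 : ℕ) : ℝ) : ℝ) : ℂ) * ((Real.sqrt ((k + 1 : ℕ) : ℝ) : ℝ) : ℂ)
          = ((k + 1 : ℕ) : ℂ) := by
        rw [← Complex.ofReal_mul, Real.mul_self_sqrt (by positivity)]; simp
      have h3 : ((k + 1 : ℕ) : ℂ) / ((Real.sqrt (k + 1).factorial : ℝ) : ℂ) =
          ((Real.sqrt ((k + 1 : ℕ) : ℝ) : ℝ) : ℂ) / ((Real.sqrt k.factorial : ℝ) : ℂ) := by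
        push_cast at h h2 ⊢
        linear_combination ((Real.sqrt (k + 1) : ℝ) : ℂ) * h -
          h2 / ((Real.sqrt (k + 1).factorial : ℝ) : ℂ)
      simp only [Nat.add_sub_cancel]
      linear_combination (conj c * γ' m * γ s m ^ k * ∏ i ∈ Finset.univ.erase m,
        (γ s i ^ n i / ((Real.sqrt (n i).factorial : ℝ) : ℂ))) * h3

/-- The flow is exp(−s²|α|²/2 − s⟨α,β⟩) e(β + sα). Only α is conjugated, never s, so it is
holomorphic in s. -/
lemma displacement_expVec {M : ℕ} (α β : Fin M → ℂ) :
    displacement α (expVec β) =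
      Complex.exp (-(∑ m, conj (α m) * α m) / 2 - ∑ m, conj (α m) * β m) • expVec (β + α) := by
  have h := expOp_apply_flow (isExpGenerator_displacementGen α)
    (fun s => Complex.exp (-(∑ m, conj (α m) * α m) / 2 * s ^ 2 - (∑ m, conj (α m) * β m) * s) •
      expVec (fun m => β m + s * α m)) ?_
  · simpa [displacement, Pi.add_def] using h
  intro f s
  simp only [inner_smul_right]
  have h1 : HasDerivAt (fun s => Complex.exp
      (-(∑ m, conj (α m) * α m) / 2 * s ^ 2 - (∑ m, conj (α m) * β m) * s)) _ s :=
    (((hasDerivAt_pow 2 s).const_mul (-(∑ m, conj (α m) * α m) / 2)).sub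
      ((hasDerivAt_id s).const_mul (∑ m, conj (α m) * β m))).cexp
  have h2 := hasDerivAt_inner_expVec (γ := fun s m => β m + s * α m) (γ' := α) (s := s)
    (fun m => by simpa using ((hasDerivAt_id s).mul_const (α m)).const_add (β m)) f
  refine (h1.mul h2).congr_deriv ?_
  simp only [displacementGen, LinearMap.sum_apply, LinearMap.sub_apply, LinearMap.smul_apply,
    map_sum, map_sub, map_smul, sum_inner, inner_sub_left, inner_smul_left, inner_creFin_expVec,
    Complex.conj_conj, Finset.sum_sub_distrib]
  have e1 : ∑ m, conj (α m) * (β m * inner ℂ (toFock f) (expVec fun m => β m + s * α m)) =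
    (∑ m, conj (α m) * β m) * inner ℂ (toFock f) (expVec fun m => β m + s * α m) := by
    rw [Finset.sum_mul]; exact Finset.sum_congr rfl fun m _ => by ring
  have e2 : ∑ m, conj (α m) * (s * α m * inner ℂ (toFock f) (expVec fun m => β m + s * α m)) =
    (∑ m, conj (α m) * α m) * s * inner ℂ (toFock f) (expVec fun m => β m + s * α m) := by
    rw [Finset.sum_mul, Finset.sum_mul]; exact Finset.sum_congr rfl fun m _ => by ring
  simp only [id, Nat.cast_ofNat, Nat.add_one_sub_one, pow_one]
  simp only [add_mul, mul_add, Finset.sum_add_distrib, e1, e2, Pi.sub_apply]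
  ring

section
attribute [local instance] Matrix.linftyOpNormedRing Matrix.linftyOpNormedAlgebra

lemma hasDerivAt_exp_smul_mulVec {M : ℕ} (L : Matrix (Fin M) (Fin M) ℂ) (β : Fin M → ℂ)
    (s : ℂ) (m : Fin M) :
    HasDerivAt (fun s : ℂ => (NormedSpace.exp (s • L)).mulVec β m)
      (L.mulVec ((NormedSpace.exp (s • L)).mulVec β) m) s := by
  have h := hasDerivAt_exp_smul_const' (𝕂 := ℂ) L s
  let ℓ : Matrix (Fin M) (Fin M) ℂ →ₗ[ℂ] ℂ :=
    (LinearMap.proj m).comp ((Matrix.mulVecBilin ℂ ℂ).flip β)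
  have h2 := (LinearMap.toContinuousLinearMap ℓ).hasFDerivAt.comp_hasDerivAt s h
  rw [Matrix.mulVec_mulVec]
  exact h2
end

/-- The flow is e(e^{sL}β): the creation part differentiates the amplitude, the annihilation part
reads it off as an eigenvalue. -/
lemma bilinearExp_expVec {M : ℕ} (L : Matrix (Fin M) (Fin M) ℂ) (hL : L.conjTranspose = -L)
    (β : Fin M → ℂ) :
    bilinearExp L hL (expVec β) = expVec ((NormedSpace.exp L).mulVec β) := by
  have h := expOp_apply_flow (isExpGenerator_bilinearGen L hL)
    (fun s => expVec ((NormedSpace.exp (s • L)).mulVec β)) ?_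
  · simpa [bilinearExp] using h
  intro f s
  refine (hasDerivAt_inner_expVec (fun m => hasDerivAt_exp_smul_mulVec L β s m) f).congr_deriv ?_
  set γ := (NormedSpace.exp (s • L)).mulVec β
  simp only [bilinearGen, LinearMap.sum_apply, LinearMap.smul_apply, LinearMap.comp_apply,
    map_sum, map_smul, sum_inner, inner_smul_left, inner_creFin_expVec]
  rw [Finset.sum_comm, ← Finset.sum_neg_distrib]
  refine Finset.sum_congr rfl fun j _ => ?_
  rw [Matrix.mulVec, dotProduct, Finset.sum_mul, ← Finset.sum_neg_distrib]
  refine Finset.sum_congr rfl fun i _ => ?_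
  have h := congrFun (congrFun hL j) i
  simp only [Matrix.conjTranspose_apply, Matrix.neg_apply] at h
  rw [starRingEnd_apply, h]
  ring

lemma exp_parityMatrix (M : ℕ) : NormedSpace.exp (parityMatrix M) = -1 := by
  have h : parityMatrix M = Matrix.diagonal fun _ => -(Complex.I * Real.pi) := by
    rw [parityMatrix, Matrix.smul_one_eq_diagonal]
  have h2 : Complex.exp (-(Complex.I * Real.pi)) = -1 := by
    rw [Complex.exp_neg, mul_comm, Complex.exp_pi_mul_I]; norm_num
  rw [h, Matrix.exp_diagonal, ← Matrix.diagonal_one, Matrix.diagonal_neg]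
  congr 1
  funext i
  rw [Pi.coe_exp, ← Complex.exp_eq_exp_ℂ, h2]

lemma parity_expVec {M : ℕ} (β : Fin M → ℂ) : parity M (expVec β) = expVec (-β) := by
  rw [parity, bilinearExp_expVec, exp_parityMatrix, Matrix.neg_mulVec, Matrix.one_mulVec]

lemma displacementGen_neg {M : ℕ} (α : Fin M → ℂ) : displacementGen (-α) = -displacementGen α := by
  refine LinearMap.ext fun f => ?_
  simp only [displacementGen, LinearMap.neg_apply, LinearMap.sum_apply, ← Finset.sum_neg_distrib]
  refine Finset.sum_congr rfl fun m _ => ?_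
  simp only [Pi.neg_apply, map_neg, LinearMap.sub_apply, LinearMap.smul_apply]
  module

lemma adjoint_displacement {M : ℕ} (α : Fin M → ℂ) :
    ContinuousLinearMap.adjoint (displacement α) = displacement (-α) := by
  unfold displacement
  rw [adjoint_expOp]
  congr 1
  exact (displacementGen_neg α).symm

lemma displacedParity_expVec {M : ℕ} (α β : Fin M → ℂ) :
    displacedParity α (expVec β) =
      Complex.exp (-2 * (∑ m, conj (α m) * α m) + 2 * ∑ m, conj (α m) * β m) •
        expVec (2 • α - β) := by
  simp only [displacedParity, ContinuousLinearMap.comp_apply, adjoint_displacement,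
    displacement_expVec, parity_expVec, map_smul, smul_smul, ← Complex.exp_add]
  congr 2
  · simp [mul_add, Finset.sum_add_distrib]; ring
  · abel_nf

lemma tensorVacuum_ket (M : ℕ) [NeZero M] (n : Fin 1 → ℕ) :
    tensorVacuum M (ket n) = ket (Pi.single (0 : Fin M) (n 0)) := by
  classical
  unfold tensorVacuum ket
  exact ((vacuum_kets_orthonormal M).orthogonalFamily.linearIsometry_apply_single (1 : ℂ)).trans
    (by simp [ket])

lemma adjoint_tensorVacuum_apply_self (M : ℕ) [NeZero M] (ψ : Fock 1) :
    ContinuousLinearMap.adjoint (tensorVacuum M) (tensorVacuum M ψ) = ψ := by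
  have h : ContinuousLinearMap.adjoint (tensorVacuum M) ∘L tensorVacuum M = 1 :=
    (ContinuousLinearMap.norm_map_iff_adjoint_comp_self _).mp
      (vacuum_kets_orthonormal M).orthogonalFamily.linearIsometry.norm_map
  exact congrArg (fun T : Fock 1 →L[ℂ] Fock 1 => T ψ) h

lemma tensorVacuum_expVec (M : ℕ) [NeZero M] (b : ℂ) :
    tensorVacuum M (expVec fun _ => b) = expVec (Pi.single 0 b) := by
  have h := (tensorVacuum M).hasSum (hasSum_ket (expVec fun _ => b))
  simp only [map_smul, tensorVacuum_ket] at h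
  ext k
  have h2 := (innerSL ℂ (ket k)).hasSum h
  simp only [innerSL_apply_apply, inner_smul_right, inner_ket] at h2
  rw [← inner_ket_left]
  refine h2.unique ?_
  -- Only the one-mode state with occupation k 0 can be mapped to the number state k.
  have hz : ∀ n : Fin 1 → ℕ, n ≠ (fun _ => k 0) → (expVec (fun _ => b) : Fock 1) n *
      (if k = Pi.single 0 (n 0) then 1 else 0) = 0 := by
    intro n hn
    rw [if_neg, mul_zero]
    rintro rfl
    exact hn (by funext i; simp [Subsingleton.elim i 0])
  have h3 := hasSum_single _ hz
  convert! h3 using 1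
  by_cases hk : k = Pi.single 0 (k 0)
  · rw [if_pos hk, mul_one, expVec_apply, expVec_apply,
      ← Finset.mul_prod_erase _ _ (Finset.mem_univ (0 : Fin M)), Finset.prod_eq_one]
    · simp
    · intro m hm
      have hm := Finset.ne_of_mem_erase hm
      rw [hk]
      simp [hm]
  · rw [if_neg hk, mul_zero, expVec_apply]
    -- Some mode other than the first is occupied in k, and its amplitude 0 kills the product.
    obtain ⟨m, hm⟩ := Function.ne_iff.mp hk
    have hm0 : m ≠ 0 := by rintro rfl; simp at hm
    refine Finset.prod_eq_zero (Finset.mem_univ m) ?_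
    simp only [Pi.single_eq_of_ne hm0] at hm ⊢
    simp [hm]

/-! ### One-mode exponential vectors -/

/-- Pairing with exponential vectors turns ψ into an entire function whose Taylor coefficients are
the conjugated number coefficients over √k!; totality follows by uniqueness of power series. -/
lemma hasSum_inner_expVec_one (ψ : Fock 1) (b : ℂ) :
    HasSum (fun k : ℕ => b ^ k * (conj (ψ fun _ => k) / ((Real.sqrt k.factorial : ℝ) : ℂ)))
      (inner ℂ ψ (expVec fun _ => b)) := by
  have h := (Equiv.hasSum_iff (Equiv.funUnique (Fin 1) ℕ).symm).mpr
    (hasSum_inner_ket ψ (expVec fun _ => b))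
  refine h.congr_fun fun k => ?_
  simp only [Function.comp_apply, ← inner_conj_symm ψ, inner_ket_left, expVec_apply]
  have h5 : (Equiv.funUnique (Fin 1) ℕ).symm k = fun _ => k := rfl
  simp only [h5, Finset.univ_unique, Finset.prod_const, Finset.card_singleton, pow_one]
  ring

lemma hasFPowerSeriesAt_inner_expVec_one (ψ : Fock 1) :
    HasFPowerSeriesAt (fun b => inner ℂ ψ (expVec fun _ => b))
      (FormalMultilinearSeries.ofScalars ℂ
        fun k : ℕ => conj (ψ fun _ => k) / ((Real.sqrt k.factorial : ℝ) : ℂ)) 0 := by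
  rw [hasFPowerSeriesAt_iff]
  refine Filter.Eventually.of_forall fun b => ?_
  simpa using hasSum_inner_expVec_one ψ b

/-- The exponential vectors are total in the one-mode space. -/
lemma eq_zero_of_inner_expVec_one {ψ : Fock 1}
    (h : ∀ b, inner ℂ ψ (expVec fun _ => b) = (0 : ℂ)) : ψ = 0 := by
  have h1 := hasFPowerSeriesAt_inner_expVec_one ψ
  simp only [h] at h1
  have h2 := h1.eq_zero
  ext n
  have h3 := congrArg (fun p => FormalMultilinearSeries.coeff p (n 0)) h2
  have h4 : ((Real.sqrt (n 0).factorial : ℝ) : ℂ) ≠ 0 := by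
    exact_mod_cast (Real.sqrt_pos.mpr (by positivity)).ne'
  have h5 : (fun _ => n 0) = n := funext fun i => by rw [Subsingleton.elim i 0]
  simp only [FormalMultilinearSeries.coeff_ofScalars, h5] at h3
  have h6 : FormalMultilinearSeries.coeff (0 : FormalMultilinearSeries ℂ ℂ ℂ) (n 0) = 0 := rfl
  simpa [h4, h6] using h3

lemma ext_expVec_one {A B : Fock 1 →L[ℂ] Fock 1}
    (h : ∀ b, A (expVec fun _ => b) = B (expVec fun _ => b)) : A = B := by
  ext ψ n
  have h0 := eq_zero_of_inner_expVec_one (ψ := ContinuousLinearMap.adjoint (A - B) (ket n))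
    fun b => by
      rw [ContinuousLinearMap.adjoint_inner_left]
      simp [h]
  have h1 : inner ℂ (ket n) ((A - B) ψ) = (0 : ℂ) := by
    rw [← ContinuousLinearMap.adjoint_inner_left, h0, inner_zero_left]
  rw [← inner_ket_left, ← inner_ket_left, ← sub_eq_zero, ← inner_sub_right]
  exact h1

/-- The one-photon state is the coefficient of b in e(b), because √1! = 1. -/
lemma inner_ket_one_eq_deriv (B : Fock 1 →L[ℂ] Fock 1) (n : Fin 1 → ℕ) :
    inner ℂ (ket n) (B (ket fun _ => 1)) =
      deriv (fun b => inner ℂ (ket n) (B (expVec fun _ => b))) 0 := by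
  have h := (hasFPowerSeriesAt_inner_expVec_one (ContinuousLinearMap.adjoint B (ket n))).deriv
  simp only [ContinuousLinearMap.adjoint_inner_left] at h
  rw [h]
  change _ = FormalMultilinearSeries.coeff _ 1
  rw [FormalMultilinearSeries.coeff_ofScalars, ← inner_ket_left, ContinuousLinearMap.adjoint_inner_right, inner_conj_symm]
  simp

/-! ### Trace of a conjugated state -/

lemma summable_norm_sq_prod {M N : ℕ} {P : Fock M →L[ℂ] Fock N}
    (hP : Summable fun k => ‖P (ket k)‖ ^ 2) :
    Summable fun p : (Fin M → ℕ) × (Fin N → ℕ) => ‖inner ℂ (ket p.2) (P (ket p.1))‖ ^ 2 := by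
  rw [summable_prod_of_nonneg fun _ => by positivity]
  refine ⟨fun k => (hasSum_norm_inner_ket (P (ket k))).summable, ?_⟩
  simpa only [(hasSum_norm_inner_ket _).tsum_eq] using hP

/-- `tr (P Q†) = tr (Q† P)` for Hilbert–Schmidt operators `P` and `Q`. -/
lemma tsum_inner_adjoint_comm {M N : ℕ} {P Q : Fock M →L[ℂ] Fock N}
    (hP : Summable fun k => ‖P (ket k)‖ ^ 2) (hQ : Summable fun k => ‖Q (ket k)‖ ^ 2) :
    ∑' n, inner ℂ (ContinuousLinearMap.adjoint P (ket n)) (ContinuousLinearMap.adjoint Q (ket n)) =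
      ∑' k, inner ℂ (Q (ket k)) (P (ket k)) := by
  have hF : Summable fun p : (Fin M → ℕ) × (Fin N → ℕ) =>
      inner ℂ (Q (ket p.1)) (ket p.2) * inner ℂ (ket p.2) (P (ket p.1)) := by
    refine Summable.of_norm_bounded
      ((summable_norm_sq_prod hP).add (summable_norm_sq_prod hQ)) fun p => ?_
    rw [norm_mul, norm_inner_symm]
    nlinarith [sq_nonneg (‖inner ℂ (ket p.2) (P (ket p.1))‖ - ‖inner ℂ (ket p.2) (Q (ket p.1))‖),
      sq_nonneg ‖inner ℂ (ket p.2) (P (ket p.1))‖, sq_nonneg ‖inner ℂ (ket p.2) (Q (ket p.1))‖]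
  have h1 : ∀ k, ∑' n, inner ℂ (Q (ket k)) (ket n) * inner ℂ (ket n) (P (ket k)) =
      inner ℂ (Q (ket k)) (P (ket k)) := fun k => (hasSum_inner_ket _ _).tsum_eq
  have h2 : ∀ n, ∑' k, inner ℂ (Q (ket k)) (ket n) * inner ℂ (ket n) (P (ket k)) =
      inner ℂ (ContinuousLinearMap.adjoint P (ket n)) (ContinuousLinearMap.adjoint Q (ket n)) := by
    intro n
    rw [← (hasSum_inner_ket _ _).tsum_eq]
    refine tsum_congr fun k => ?_
    rw [ContinuousLinearMap.adjoint_inner_left, ContinuousLinearMap.adjoint_inner_right, mul_comm]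
  simp only [← h1, ← h2]
  exact (Summable.tsum_comm (f := fun k n =>
    inner ℂ (Q (ket k)) (ket n) * inner ℂ (ket n) (P (ket k))) hF)

lemma _root_.ContinuousLinearMap.IsPositive.exists_sqrt {H : Type*} [NormedAddCommGroup H]
    [InnerProductSpace ℂ H] [CompleteSpace H] {ρ : H →L[ℂ] H} (hρ : ρ.IsPositive) :
    ∃ S : H →L[ℂ] H, ContinuousLinearMap.adjoint S = S ∧ S ∘L S = ρ := by
  have h0 : 0 ≤ ρ := (ContinuousLinearMap.nonneg_iff_isPositive ρ).mpr hρ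
  exact ⟨CFC.sqrt ρ,
    ((ContinuousLinearMap.nonneg_iff_isPositive _).mp (CFC.sqrt_nonneg ρ)).isSelfAdjoint,
    CFC.sqrt_mul_sqrt_self ρ h0⟩

/-- The square root S is Hilbert–Schmidt since ‖S|k⟩‖² = ⟨k|ρ|k⟩. This replaces a theory of
trace-class operators. -/
lemma IsState.exists_sqrt {M : ℕ} {ρ : Fock M →L[ℂ] Fock M} (hρ : IsState ρ) :
    ∃ S : Fock M →L[ℂ] Fock M, ContinuousLinearMap.adjoint S = S ∧ S ∘L S = ρ ∧
      Summable fun k => ‖S (ket k)‖ ^ 2 := by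
  obtain ⟨S, hS, hSS⟩ := hρ.1.exists_sqrt
  refine ⟨S, hS, hSS, (Complex.reCLM.hasSum hρ.2).summable.congr fun k => ?_⟩
  rw [← hSS, ContinuousLinearMap.comp_apply, ← ContinuousLinearMap.adjoint_inner_left, hS,
    inner_self_eq_norm_sq_to_K]
  simp [← Complex.ofReal_pow]

lemma summable_norm_sq_comp {M N : ℕ} {S : Fock M →L[ℂ] Fock M}
    (hS : Summable fun k => ‖S (ket k)‖ ^ 2) (T : Fock M →L[ℂ] Fock N) :
    Summable fun k => ‖(T ∘L S) (ket k)‖ ^ 2 := by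
  refine Summable.of_nonneg_of_le (fun _ => by positivity) (fun k => ?_) (hS.mul_left (‖T‖ ^ 2))
  rw [← mul_pow]
  exact pow_le_pow_left₀ (norm_nonneg _) (T.le_opNorm _) 2

/-- `tr (V ρ V† B) = tr (ρ V† B V)`. -/
lemma trace_conj_comp {M N : ℕ} {ρ : Fock M →L[ℂ] Fock M} (hρ : IsState ρ)
    (V : Fock M →L[ℂ] Fock N) (B : Fock N →L[ℂ] Fock N) :
    trace ((V ∘L ρ ∘L ContinuousLinearMap.adjoint V) ∘L B) =
      trace (ρ ∘L ContinuousLinearMap.adjoint V ∘L B ∘L V) := by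
  obtain ⟨S, hS, hSS, hsum⟩ := hρ.exists_sqrt
  -- Both traces are brought to the common value ∑ₖ ⟨VSk, BVSk⟩.
  have e1 := tsum_inner_adjoint_comm (summable_norm_sq_comp hsum V)
    (summable_norm_sq_comp hsum (ContinuousLinearMap.adjoint B ∘L V))
  have e2 := tsum_inner_adjoint_comm hsum (summable_norm_sq_comp hsum
    (ContinuousLinearMap.adjoint V ∘L ContinuousLinearMap.adjoint B ∘L V))
  simp only [ContinuousLinearMap.adjoint_comp, ContinuousLinearMap.adjoint_adjoint, hS,
    ContinuousLinearMap.comp_apply] at e1 e2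
  simp only [trace, ← hSS, ContinuousLinearMap.comp_apply]
  have l1 : ∀ n, inner ℂ (ket n) (V (S (S (ContinuousLinearMap.adjoint V (B (ket n)))))) =
      inner ℂ (S (ContinuousLinearMap.adjoint V (ket n)))
        (S (ContinuousLinearMap.adjoint V (B (ket n)))) := fun n => by
    rw [← ContinuousLinearMap.adjoint_inner_left, ← ContinuousLinearMap.adjoint_inner_left, hS]
  have l2 : ∀ k, inner ℂ (ket k) (S (S (ContinuousLinearMap.adjoint V (B (V (ket k)))))) =
      inner ℂ (S (ket k)) (S (ContinuousLinearMap.adjoint V (B (V (ket k))))) := fun k => by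
    rw [← ContinuousLinearMap.adjoint_inner_left, hS]
  simp only [l1, l2, e1, e2, ContinuousLinearMap.adjoint_inner_left]

/-! ### Balanced beamsplitters -/

lemma bilinearGen_single_single {M : ℕ} (L : Matrix (Fin M) (Fin M) ℂ) (j : Fin M) :
    bilinearGen L (Finsupp.single (Pi.single j 1) 1) =
      ∑ i, L i j • Finsupp.single (Pi.single i 1) 1 := by
  simp only [bilinearGen, LinearMap.sum_apply, LinearMap.smul_apply, LinearMap.comp_apply,
    annFin_single, map_smul, creFin_single]
  refine Finset.sum_congr rfl fun i _ => ?_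
  rw [Finset.sum_eq_single j]
  · simp
  · intro k _ hk
    simp [hk]
  · simp

/-- `e^{a† L a}` acts on one-particle states by the matrix `e^L`. -/
lemma bilinearExp_ket_single {M : ℕ} (L : Matrix (Fin M) (Fin M) ℂ) (hL : L.conjTranspose = -L)
    (j : Fin M) :
    bilinearExp L hL (ket (Pi.single j 1)) =
      ∑ i, NormedSpace.exp L i j • ket (Pi.single i 1) := by
  have h := expOp_apply_flow (isExpGenerator_bilinearGen L hL)
    (fun s => ∑ i, (NormedSpace.exp (s • L)).mulVec (Pi.single j 1) i • ket (Pi.single i 1)) ?_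
  · simpa [bilinearExp, Pi.single_apply, Matrix.one_apply, ite_smul] using h
  intro f s
  simp only [inner_sum, inner_smul_right]
  refine (HasDerivAt.fun_sum fun i _ =>
    (hasDerivAt_exp_smul_mulVec L (Pi.single j 1) s i).mul_const _).congr_deriv ?_
  set γ := (NormedSpace.exp (s • L)).mulVec (Pi.single j 1)
  have h1 : ∀ k : Fin M, inner ℂ (toFock (bilinearGen L f)) (ket (Pi.single k 1)) =
      -∑ i, L i k * inner ℂ (toFock f) (ket (Pi.single i 1)) := by
    intro k
    have h2 := bilinearGen_skew L hL f (Finsupp.single (Pi.single k 1) 1)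
    rw [bilinearGen_single_single] at h2
    simpa [inner_sum, inner_smul_right] using h2
  simp only [h1, mul_neg, Finset.sum_neg_distrib, neg_neg, Matrix.mulVec, dotProduct,
    Finset.sum_mul, Finset.mul_sum]
  rw [Finset.sum_comm]
  exact Finset.sum_congr rfl fun i _ => Finset.sum_congr rfl fun k _ => by ring

lemma bilinearExp_ket_zero {M : ℕ} (L : Matrix (Fin M) (Fin M) ℂ) (hL : L.conjTranspose = -L) :
    bilinearExp L hL (ket 0) = ket 0 := by
  have h : expVec (0 : Fin M → ℂ) = ket 0 := by
    ext n
    rw [expVec_apply, ket_apply]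
    by_cases hn : n = 0
    · subst hn; simp
    · obtain ⟨m, hm⟩ := Function.ne_iff.mp hn
      rw [if_neg hn]
      exact Finset.prod_eq_zero (Finset.mem_univ m) (by simp at hm; simp [hm])
  rw [← h, bilinearExp_expVec, Matrix.mulVec_zero]

lemma annihilation_apply {M : ℕ} (m : Fin M) (ψ : (annihilation (M := M) m).domain)
    (n : Fin M → ℕ) :
    annihilation m ψ n = ((Real.sqrt (n m + 1) : ℝ) : ℂ) * (ψ : Fock M) (n + Pi.single m 1) := rfl

/-- Test the balance identity on one photon in the first mode and pair with the vacuum. Every a_{m'}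
with m' ≠ 0 kills that photon, so the right side gives 1; U fixes the vacuum, so the left side gives
√M times the matrix entry. -/
lemma IsBalanced.exp_apply_zero {M : ℕ} [NeZero M] {L : Matrix (Fin M) (Fin M) ℂ}
    {hL : L.conjTranspose = -L} {c : Fin M → Fin M → ℂ} (h : IsBalanced (bilinearExp L hL) c)
    (m : Fin M) : NormedSpace.exp L m 0 = ((Real.sqrt M : ℝ) : ℂ)⁻¹ := by
  obtain ⟨hd, he⟩ := h m (Finsupp.single (Pi.single 0 1) 1)
  have h1 : toFock (annFin 0 (Finsupp.single (Pi.single (0 : Fin M) 1) 1)) +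
      ∑ m' ∈ Finset.univ.erase 0, c m m' •
        toFock (annFin m' (Finsupp.single (Pi.single (0 : Fin M) 1) 1)) = ket 0 := by
    rw [Finset.sum_eq_zero, annFin_single]
    · simp
    · intro m' hm'
      rw [annFin_single]
      simp [Finset.ne_of_mem_erase hm']
  rw [h1] at he
  have h2 := congrArg (fun ψ => inner ℂ (ket 0) ψ) he
  simp only [inner_smul_right, ContinuousLinearMap.adjoint_inner_right, bilinearExp_ket_zero,
    inner_ket_left, annihilation_apply, toFock_single, one_smul, bilinearExp_ket_single] at h2
  have h3 : (∑ i, NormedSpace.exp L i 0 • (ket (Pi.single i 1) : Fock M))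
      (0 + Pi.single m 1) = NormedSpace.exp L m 0 := by
    rw [← inner_ket_left, inner_sum, Finset.sum_eq_single m]
    · simp [inner_smul_right, norm_ket]
    · intro i _ hi
      rw [inner_smul_right, inner_ket, if_neg, mul_zero]
      intro h4
      have := congrFun h4 m
      simp [Ne.symm hi] at this
    · simp
  rw [h3, ket_apply] at h2
  simp only [Pi.zero_apply, Nat.cast_zero, zero_add, Real.sqrt_one, Complex.ofReal_one, one_mul,
    if_true] at h2
  exact eq_inv_of_mul_eq_one_right h2

lemma pureState_apply {M : ℕ} (ψ φ : Fock M) : pureState ψ φ = inner ℂ ψ φ • ψ := by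
  simp [pureState]

lemma conj_pureState {M N : ℕ} (V : Fock M →L[ℂ] Fock N) (ψ : Fock M) :
    V ∘L pureState ψ ∘L ContinuousLinearMap.adjoint V = pureState (V ψ) := by
  ext1 φ
  simp only [ContinuousLinearMap.comp_apply, pureState_apply, map_smul,
    ContinuousLinearMap.adjoint_inner_right]

lemma interfere_eq_conj {M : ℕ} [NeZero M] (U : Fock M →L[ℂ] Fock M) (ρ : Fock 1 →L[ℂ] Fock 1) :
    interfere U ρ = (U ∘L tensorVacuum M) ∘L ρ ∘L
      ContinuousLinearMap.adjoint (U ∘L tensorVacuum M) := by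
  rw [interfere, withVacua, ContinuousLinearMap.adjoint_comp]
  rfl

lemma bilinearExp_tensorVacuum_ket_one {M : ℕ} [NeZero M] {L : Matrix (Fin M) (Fin M) ℂ}
    (hL : L.conjTranspose = -L)
    (hcol : ∀ m, NormedSpace.exp L m 0 = ((Real.sqrt M : ℝ) : ℂ)⁻¹) :
    bilinearExp L hL (tensorVacuum M (ket fun _ => 1)) = wState M := by
  rw [tensorVacuum_ket, bilinearExp_ket_single, wState, Finset.smul_sum]
  simp only [hcol]

lemma bilinearExp_tensorVacuum_expVec {M : ℕ} [NeZero M] {L : Matrix (Fin M) (Fin M) ℂ}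
    (hL : L.conjTranspose = -L)
    (hcol : ∀ m, NormedSpace.exp L m 0 = ((Real.sqrt M : ℝ) : ℂ)⁻¹) (b : ℂ) :
    bilinearExp L hL (tensorVacuum M (expVec fun _ => b)) =
      expVec fun _ => ((Real.sqrt M : ℝ) : ℂ)⁻¹ * b := by
  rw [tensorVacuum_expVec, bilinearExp_expVec]
  congr 1
  funext m
  rw [Matrix.mulVec_single, Pi.smul_apply, Matrix.col_apply, hcol, op_smul_eq_mul]

/-- Displaced parity on the diagonal, pulled back through a balanced beamsplitter. -/
lemma adjoint_comp_displacedParity_comp {M : ℕ} [NeZero M] {L : Matrix (Fin M) (Fin M) ℂ}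
    (hL : L.conjTranspose = -L)
    (hcol : ∀ m, NormedSpace.exp L m 0 = ((Real.sqrt M : ℝ) : ℂ)⁻¹) (α : ℂ) :
    ContinuousLinearMap.adjoint (bilinearExp L hL ∘L tensorVacuum M) ∘L
        displacedParity (fun _ => α) ∘L (bilinearExp L hL ∘L tensorVacuum M) =
      displacedParity (fun _ => ((Real.sqrt M : ℝ) : ℂ) * α) := by
  refine ext_expVec_one fun b => ?_
  have hM : ((Real.sqrt M : ℝ) : ℂ) * ((Real.sqrt M : ℝ) : ℂ) = M := by
    rw [← Complex.ofReal_mul, Real.mul_self_sqrt (by positivity)]; simp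
  have h0 : ((Real.sqrt M : ℝ) : ℂ) ≠ 0 := by
    intro h
    rw [h, zero_mul] at hM
    exact NeZero.ne M (by exact_mod_cast hM.symm)
  have hV := bilinearExp_tensorVacuum_expVec hL hcol
    (2 * (((Real.sqrt M : ℝ) : ℂ) * α) - b)
  -- The reflected amplitude is again constant over the modes, so it lies in the image of V and V†V
  -- = 1 applies.
  have e1 : (2 • (fun _ => α) - fun _ => ((Real.sqrt M : ℝ) : ℂ)⁻¹ * b : Fin M → ℂ) =
      fun _ => ((Real.sqrt M : ℝ) : ℂ)⁻¹ * (2 * (((Real.sqrt M : ℝ) : ℂ) * α) - b) := by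
    funext m
    simp only [Pi.sub_apply, two_smul, Pi.add_apply]
    field_simp
    ring
  have e2 : (2 • (fun _ => ((Real.sqrt M : ℝ) : ℂ) * α) - fun _ => b : Fin 1 → ℂ) =
      fun _ => 2 * (((Real.sqrt M : ℝ) : ℂ) * α) - b := by
    funext m
    simp
  simp only [ContinuousLinearMap.adjoint_comp, ContinuousLinearMap.comp_apply,
    bilinearExp_tensorVacuum_expVec hL hcol, displacedParity_expVec, map_smul, e1, e2]
  rw [← hV, bilinearExp, adjoint_expOp_apply_self, adjoint_tensorVacuum_apply_self]
  -- The exponents agree because M = √M·√M: both the |α|² terms and the cross terms with b match.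
  congr 2
  simp only [Finset.sum_const, Finset.card_univ, Fintype.card_fin, nsmul_eq_mul, map_mul,
    Complex.conj_ofReal, Nat.cast_one, one_mul, ← hM]
  field_simp

lemma wigner_interfere {M : ℕ} [NeZero M] {L : Matrix (Fin M) (Fin M) ℂ}
    (hL : L.conjTranspose = -L)
    (hcol : ∀ m, NormedSpace.exp L m 0 = ((Real.sqrt M : ℝ) : ℂ)⁻¹)
    {ρ : Fock 1 →L[ℂ] Fock 1} (hρ : IsState ρ) (α : ℂ) :
    wigner (interfere (bilinearExp L hL) ρ) (fun _ => α) =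
      ((2 / Real.pi : ℝ) : ℂ) ^ (M - 1) * wigner ρ (fun _ => ((Real.sqrt M : ℝ) : ℂ) * α) := by
  rw [wigner, wigner, interfere_eq_conj, trace_conj_comp hρ,
    adjoint_comp_displacedParity_comp hL hcol, ← mul_assoc, ← pow_add,
    Nat.sub_add_cancel NeZero.one_le]

lemma interfere_ket_one {M : ℕ} [NeZero M] {L : Matrix (Fin M) (Fin M) ℂ}
    (hL : L.conjTranspose = -L)
    (hcol : ∀ m, NormedSpace.exp L m 0 = ((Real.sqrt M : ℝ) : ℂ)⁻¹) :
    interfere (bilinearExp L hL) (pureState (ket fun _ => 1)) = pureState (wState M) := by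
  rw [interfere_eq_conj, conj_pureState, ContinuousLinearMap.comp_apply,
    bilinearExp_tensorVacuum_ket_one hL hcol]

/-! ### Existence of a balanced beamsplitter -/

section
attribute [local instance] Matrix.linftyOpNormedRing Matrix.linftyOpNormedAlgebra

lemma exp_mulVec_of_eigenvector {M : ℕ} {L : Matrix (Fin M) (Fin M) ℂ} {v : Fin M → ℂ} {c : ℂ}
    (h : L.mulVec v = c • v) : (NormedSpace.exp L).mulVec v = Complex.exp c • v := by
  have hpow : ∀ k : ℕ, (L ^ k).mulVec v = c ^ k • v := by
    intro k
    induction k with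
    | zero => simp
    | succ k ih =>
      rw [pow_succ, ← Matrix.mulVec_mulVec, h, Matrix.mulVec_smul, ih, smul_smul, pow_succ']
  have h1 := (LinearMap.toContinuousLinearMap ((Matrix.mulVecBilin ℂ ℂ).flip v)).hasSum
    (NormedSpace.exp_series_hasSum_exp' (𝕂 := ℂ) L)
  have h2 := (NormedSpace.exp_series_hasSum_exp' (𝕂 := ℂ) c).smul_const v
  rw [← Complex.exp_eq_exp_ℂ] at h2
  refine h1.unique (h2.congr_fun fun k => ?_)
  simp [hpow, smul_smul]
end

/-- The Householder reflection exchanging `e₁` and `(1, …, 1)/√M` has a skew-Hermitian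
logarithm. -/
lemma exists_balanced_log (M : ℕ) [NeZero M] :
    ∃ L : Matrix (Fin M) (Fin M) ℂ, L.conjTranspose = -L ∧
      ∀ m, NormedSpace.exp L m 0 = ((Real.sqrt M : ℝ) : ℂ)⁻¹ := by
  set u : Fin M → ℝ := fun _ => (Real.sqrt M)⁻¹ with hu
  set e : Fin M → ℝ := Pi.single 0 1 with he
  set d : ℝ := ∑ i, (e i - u i) ^ 2 with hd
  set v : Fin M → ℂ := fun i => ((e i - u i : ℝ) : ℂ) with hv
  set w : Fin M → ℂ := fun i => ((e i + u i : ℝ) : ℂ) with hw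
  -- With v = e₁ − u and d = |v|², this is iπ times the projection onto v, whose exponential is the
  -- reflection fixing w = e₁ + u and negating v.
  set L : Matrix (Fin M) (Fin M) ℂ := fun i j => Complex.I * Real.pi / d * (v i * v j) with hLdef
  have hM : (0 : ℝ) < M := by exact_mod_cast NeZero.pos M
  have hmul : ∀ x : Fin M → ℂ, L.mulVec x = (Complex.I * Real.pi / d * ∑ j, v j * x j) • v := by
    intro x
    funext i
    simp only [Matrix.mulVec, dotProduct, hLdef, Pi.smul_apply, smul_eq_mul, Finset.mul_sum,
      Finset.sum_mul]
    exact Finset.sum_congr rfl fun j _ => by ring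
  have hLw : L.mulVec w = (0 : ℂ) • w := by
    have h1 : ∑ j, v j * w j = ((∑ j, (e j ^ 2 - u j ^ 2) : ℝ) : ℂ) := by
      push_cast
      exact Finset.sum_congr rfl fun j _ => by simp only [hv, hw]; push_cast; ring
    have h2 : ∑ j, (e j ^ 2 - u j ^ 2) = 0 := by
      rw [Finset.sum_sub_distrib]
      simp only [hu, he, inv_pow, Real.sq_sqrt hM.le, Finset.sum_const, Finset.card_univ,
        Fintype.card_fin, nsmul_eq_mul]
      rw [Finset.sum_eq_single 0 (fun j _ hj => by simp [hj]) (by simp)]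
      simp [hM.ne']
    rw [hmul, h1, h2]
    simp
  have hLv : L.mulVec v = (Real.pi * Complex.I) • v := by
    have h1 : ∑ j, v j * v j = (d : ℂ) := by
      rw [hd]
      push_cast
      exact Finset.sum_congr rfl fun j _ => by simp only [hv]; push_cast; ring
    rw [hmul, h1]
    -- For M = 1 one has v = 0 and d = 0, so both sides vanish.
    by_cases hd0 : d = 0
    · have hv0 : v = 0 := by
        funext i
        have h2 := (Finset.sum_eq_zero_iff_of_nonneg fun i _ => sq_nonneg (e i - u i)).mp hd0 i
          (Finset.mem_univ i)
        simp only [hv, pow_eq_zero_iff two_ne_zero] at h2 ⊢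
        simp [h2]
      simp [hv0]
    · have hd1 : (d : ℂ) ≠ 0 := by exact_mod_cast hd0
      congr 1
      field_simp
  refine ⟨L, ?_, fun m => ?_⟩
  · ext i j
    have hLij : ∀ i j, L i j = Complex.I * Real.pi / d * (v i * v j) := fun _ _ => rfl
    rw [Matrix.conjTranspose_apply, Matrix.neg_apply, hLij, hLij]
    simp [hv]
    ring
  -- The reflection sends e₁ = (w + v)/2 to (w − v)/2 = u.
  · have h1 : (Pi.single 0 1 : Fin M → ℂ) = (1 / 2 : ℂ) • w + (1 / 2 : ℂ) • v := by
      funext i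
      simp only [hw, hv, he, hu, Pi.add_apply, Pi.smul_apply, smul_eq_mul]
      by_cases hi : i = 0
      · subst hi; simp; ring
      · simp [hi]
    have h2 : (NormedSpace.exp L).mulVec (Pi.single 0 1) m = NormedSpace.exp L m 0 := by simp
    rw [← h2, h1, Matrix.mulVec_add, Matrix.mulVec_smul, Matrix.mulVec_smul,
      exp_mulVec_of_eigenvector hLw, exp_mulVec_of_eigenvector hLv, Complex.exp_pi_mul_I]
    simp only [hw, hv, hu, Pi.add_apply, Pi.smul_apply, smul_eq_mul, Complex.exp_zero]
    push_cast
    ring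

/-! ### Absolute Wigner volumes along the diagonal slice -/

open MeasureTheory in
lemma lintegral_comp_ofReal_mul {r : ℝ} (hr : 0 < r) (f : ℂ → ℝ≥0∞) :
    ∫⁻ α : ℂ, f ((r : ℂ) * α) = ENNReal.ofReal (1 / r ^ 2) * ∫⁻ α, f α := by
  have h := lintegral_map_equiv (μ := (volume : Measure ℂ)) f
    (Homeomorph.smulOfNeZero r hr.ne').toMeasurableEquiv
  have h2 := Measure.map_addHaar_smul (volume : Measure ℂ) hr.ne'
  rw [Complex.finrank_real_complex, abs_of_pos (by positivity), ← one_div] at h2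
  have h3 : ⇑(Homeomorph.smulOfNeZero r hr.ne' : ℂ ≃ₜ ℂ).toMeasurableEquiv = (r • ·) := rfl
  rw [h3, h2, lintegral_smul_measure] at h
  simpa using h.symm

/-- The prefactor (π/2)^(M−1) cancels (2/π)^(M−1), and scaling the plane by √M contributes 1/M. No
integrability is needed, so infinite volumes are covered. -/
lemma diagVolume_interfere {M : ℕ} [NeZero M] {L : Matrix (Fin M) (Fin M) ℂ}
    (hL : L.conjTranspose = -L)
    (hcol : ∀ m, NormedSpace.exp L m 0 = ((Real.sqrt M : ℝ) : ℂ)⁻¹)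
    {ρ : Fock 1 →L[ℂ] Fock 1} (hρ : IsState ρ) :
    diagVolume (interfere (bilinearExp L hL) ρ) =
      ENNReal.ofReal (1 / M) * ∫⁻ α : ℂ, ‖wigner ρ (fun _ => α)‖ₑ := by
  have hM : (0 : ℝ) < M := by exact_mod_cast NeZero.pos M
  have hpi := Real.pi_pos
  simp only [diagVolume, absVolume, mul_one, mul_zero, add_zero, MeasureTheory.Measure.restrict_univ,
    wigner_interfere hL hcol hρ, enorm_mul]
  rw [MeasureTheory.lintegral_const_mul' _ _ enorm_ne_top, ← mul_assoc,
    lintegral_comp_ofReal_mul (Real.sqrt_pos.mpr hM) fun α => ‖wigner ρ fun _ => α‖ₑ,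
    Real.sq_sqrt hM.le]
  have h : ENNReal.ofReal ((Real.pi / 2) ^ (M - 1)) *
      ‖((2 / Real.pi : ℝ) : ℂ) ^ (M - 1)‖ₑ = 1 := by
    rw [← ofReal_norm, norm_pow, Complex.norm_real, Real.norm_eq_abs, abs_of_pos (by positivity),
      ← ENNReal.ofReal_mul (by positivity), ← mul_pow]
    have : Real.pi / 2 * (2 / Real.pi) = 1 := by field_simp
    simp [this]
  rw [h, one_mul]

/-! ### The one-photon state -/

lemma isState_pureState {M : ℕ} {ψ : Fock M} (hψ : ‖ψ‖ = 1) : IsState (pureState ψ) := by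
  refine ⟨InnerProductSpace.isPositive_rankOne_self ψ, ?_⟩
  have h := hasSum_inner_ket ψ ψ
  rw [inner_self_eq_norm_sq_to_K, hψ] at h
  simpa [pureState_apply, inner_smul_right] using h

lemma trace_pureState_comp {M : ℕ} (ψ : Fock M) (B : Fock M →L[ℂ] Fock M) :
    trace (pureState ψ ∘L B) = inner ℂ ψ (B ψ) := by
  rw [← ContinuousLinearMap.adjoint_inner_left, ← (hasSum_inner_ket _ ψ).tsum_eq, trace]
  refine tsum_congr fun n => ?_
  rw [ContinuousLinearMap.comp_apply, pureState_apply, inner_smul_right,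
    ContinuousLinearMap.adjoint_inner_left]

lemma wigner_one_photon (α : ℂ) :
    wigner (pureState (ket fun _ => 1)) (fun _ : Fin 1 => α) =
      ((2 / Real.pi * ((4 * ‖α‖ ^ 2 - 1) * Real.exp (-2 * ‖α‖ ^ 2)) : ℝ) : ℂ) := by
  have hn : conj α * α = ((‖α‖ ^ 2 : ℝ) : ℂ) := by
    rw [← Complex.normSq_eq_conj_mul_self, Complex.normSq_eq_norm_sq]
  rw [wigner, trace_pureState_comp, inner_ket_one_eq_deriv]
  -- The component of e(2α − b) on |1⟩ is 2α − b; differentiating its product with the exponential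
  -- at b = 0 yields 4|α|² − 1.
  have hfun : (fun b : ℂ => inner ℂ (ket fun _ => 1)
      (displacedParity (fun _ : Fin 1 => α) (expVec fun _ => b))) =
      fun b => Complex.exp (-2 * (conj α * α) + 2 * (conj α * b)) * (2 * α - b) := by
    funext b
    rw [displacedParity_expVec, inner_smul_right, inner_ket_left, expVec_apply]
    simp [two_smul, two_mul]
  have hd : HasDerivAt
      (fun b => Complex.exp (-2 * (conj α * α) + 2 * (conj α * b)) * (2 * α - b)) _ 0 :=
    ((((hasDerivAt_id (0 : ℂ)).const_mul (conj α)).const_mul 2).const_add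
      (-2 * (conj α * α))).cexp.mul ((hasDerivAt_id (0 : ℂ)).const_sub (2 * α))
  rw [hfun, hd.deriv]
  push_cast at hn ⊢
  simp only [id, mul_zero, add_zero, hn]
  linear_combination (4 * (2 / (Real.pi : ℂ)) * Complex.exp (-2 * (‖α‖ : ℂ) ^ 2)) * hn

open MeasureTheory Set in
lemma lintegral_one_photon_radial :
    ∫⁻ r in Ioi (0 : ℝ), ENNReal.ofReal (r * (|4 * r ^ 2 - 1| * Real.exp (-2 * r ^ 2))) =
      ENNReal.ofReal (Real.exp (-(1 / 2)) - 1 / 4) := by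
  -- An antiderivative of minus the integrand without absolute value. The sign changes at r = 1/2,
  -- so the integral is (G(1/2) − G(0)) + G(1/2).
  set G : ℝ → ℝ := fun r => (r ^ 2 + 1 / 4) * Real.exp (-2 * r ^ 2) with hG
  have hder : ∀ r, HasDerivAt G (-(r * ((4 * r ^ 2 - 1) * Real.exp (-2 * r ^ 2)))) r := by
    intro r
    have h1 : HasDerivAt G _ r := ((hasDerivAt_pow 2 r).add_const (1 / 4)).mul
      ((hasDerivAt_pow 2 r).const_mul (-2)).exp
    refine h1.congr_deriv ?_
    simp
    ring
  have hG0 : G 0 = 1 / 4 := by simp [hG]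
  have hGh : G (1 / 2) = Real.exp (-(1 / 2)) / 2 := by
    simp only [hG]
    rw [show (-2 : ℝ) * (1 / 2) ^ 2 = -(1 / 2) by norm_num]
    ring
  have hlim : Filter.Tendsto G Filter.atTop (nhds 0) := by
    have h1 : Filter.Tendsto (fun r : ℝ => 2 * r ^ 2) Filter.atTop Filter.atTop :=
      (Filter.tendsto_pow_atTop two_ne_zero).const_mul_atTop two_pos
    have h2 := (((Real.tendsto_pow_mul_exp_neg_atTop_nhds_zero 1).const_mul (1 / 2)).add
      ((Real.tendsto_pow_mul_exp_neg_atTop_nhds_zero 0).const_mul (1 / 4))).comp h1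
    refine (h2.congr fun r => ?_).trans (by simp)
    simp only [hG, Function.comp_apply, pow_one, pow_zero, neg_mul]
    ring
  have hsplit : Ioi (0 : ℝ) = Ioc 0 (1 / 2) ∪ Ioi (1 / 2) := (Ioc_union_Ioi_eq_Ioi (by norm_num)).symm
  rw [hsplit, lintegral_union measurableSet_Ioi (Ioc_disjoint_Ioi le_rfl)]
  have hin : ∫⁻ r in Ioc (0 : ℝ) (1 / 2),
      ENNReal.ofReal (r * (|4 * r ^ 2 - 1| * Real.exp (-2 * r ^ 2))) =
      ENNReal.ofReal (Real.exp (-(1 / 2)) / 2 - 1 / 4) := by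
    have hc : Continuous fun r : ℝ => -(r * ((4 * r ^ 2 - 1) * Real.exp (-2 * r ^ 2))) := by
      fun_prop
    have h1 := intervalIntegral.integral_eq_sub_of_hasDerivAt (fun r _ => hder r)
      (hc.intervalIntegrable 0 (1 / 2))
    rw [hG0, hGh, intervalIntegral.integral_of_le (by norm_num)] at h1
    rw [← h1, ofReal_integral_eq_lintegral_ofReal]
    · refine setLIntegral_congr_fun measurableSet_Ioc fun r hr => ?_
      have : 4 * r ^ 2 - 1 ≤ 0 := by nlinarith [hr.1, hr.2]
      simp only [abs_of_nonpos this]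
      congr 1
      ring
    · exact (intervalIntegrable_iff_integrableOn_Ioc_of_le (by norm_num)).mp
        (hc.intervalIntegrable 0 (1 / 2))
    · refine (ae_restrict_iff' measurableSet_Ioc).mpr (Filter.Eventually.of_forall fun r hr => ?_)
      have h2 : 0 ≤ 1 - 4 * r ^ 2 := by nlinarith [hr.1, hr.2]
      have h3 := mul_nonneg hr.1.le (mul_nonneg h2 (Real.exp_pos (-2 * r ^ 2)).le)
      simp only [Pi.zero_apply]
      linarith
  have hout : ∫⁻ r in Ioi (1 / 2 : ℝ),
      ENNReal.ofReal (r * (|4 * r ^ 2 - 1| * Real.exp (-2 * r ^ 2))) =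
      ENNReal.ofReal (Real.exp (-(1 / 2)) / 2) := by
    have hpos : ∀ r ∈ Ioi (1 / 2 : ℝ), 0 ≤ 4 * r ^ 2 - 1 := fun r hr => by
      have : (1 / 2 : ℝ) < r := hr
      nlinarith
    have hpos' : ∀ r ∈ Ioi (1 / 2 : ℝ), 0 ≤ - -(r * ((4 * r ^ 2 - 1) * Real.exp (-2 * r ^ 2))) :=
      fun r hr => by
        have h0 : (1 / 2 : ℝ) < r := hr
        rw [neg_neg]
        exact mul_nonneg (by linarith) (mul_nonneg (hpos r hr) (Real.exp_pos _).le)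
    have hder' : ∀ r ∈ Ici (1 / 2 : ℝ), HasDerivAt (fun r => -G r)
        (- -(r * ((4 * r ^ 2 - 1) * Real.exp (-2 * r ^ 2)))) r := fun r _ => (hder r).fun_neg
    have h1 := integral_Ioi_of_hasDerivAt_of_nonneg' hder' hpos' hlim.neg
    have h2 := integrableOn_Ioi_deriv_of_nonneg' hder' hpos' hlim.neg
    rw [hGh] at h1
    rw [show Real.exp (-(1 / 2)) / 2 = -0 - -(Real.exp (-(1 / 2)) / 2) by ring, ← h1,
      ofReal_integral_eq_lintegral_ofReal h2
        ((ae_restrict_iff' measurableSet_Ioi).mpr (Filter.Eventually.of_forall hpos'))]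
    refine setLIntegral_congr_fun measurableSet_Ioi fun r hr => ?_
    simp only [abs_of_nonneg (hpos r hr), neg_neg]
  -- Keeps the inner contribution nonnegative, so the `ENNReal.ofReal` values add without
  -- truncation.
  have hexp : 1 / 2 ≤ Real.exp (-(1 / 2)) := by linarith [Real.add_one_le_exp (-(1 / 2))]
  rw [hin, hout, ← ENNReal.ofReal_add (by linarith) (by positivity)]
  congr 1
  ring

open MeasureTheory Set in
-- In polar coordinates the angle contributes 2π, so the value is 2π · (2/π) · (e^{−1/2} − 1/4).
lemma lintegral_wigner_one_photon :
    ∫⁻ α : ℂ, ‖wigner (pureState (ket fun _ => 1)) (fun _ : Fin 1 => α)‖ₑ =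
      ENNReal.ofReal (4 / Real.sqrt (Real.exp 1) - 1) := by
  have hpi := Real.pi_pos
  have hexp : 1 / 2 ≤ Real.exp (-(1 / 2)) := by linarith [Real.add_one_le_exp (-(1 / 2))]
  have hnorm : ∀ α : ℂ, ‖wigner (pureState (ket fun _ => 1)) (fun _ : Fin 1 => α)‖ₑ =
      ENNReal.ofReal (2 / Real.pi * (|4 * ‖α‖ ^ 2 - 1| * Real.exp (-2 * ‖α‖ ^ 2))) := by
    intro α
    rw [wigner_one_photon, ← ofReal_norm, Complex.norm_real, Real.norm_eq_abs, abs_mul, abs_mul,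
      abs_of_pos (Real.exp_pos _), abs_of_pos (by positivity : 0 < 2 / Real.pi)]
  simp only [hnorm]
  rw [← Complex.lintegral_comp_polarCoord_symm, polarCoord_target, Measure.volume_eq_prod,
    ← Measure.prod_restrict]
  have hpt : ∀ p : ℝ × ℝ, p ∈ Ioi (0 : ℝ) ×ˢ Ioo (-Real.pi) Real.pi →
      ENNReal.ofReal p.1 • ENNReal.ofReal (2 / Real.pi *
        (|4 * ‖Complex.polarCoord.symm p‖ ^ 2 - 1| *
          Real.exp (-2 * ‖Complex.polarCoord.symm p‖ ^ 2))) =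
      ENNReal.ofReal (p.1 * (|4 * p.1 ^ 2 - 1| * Real.exp (-2 * p.1 ^ 2))) *
        ENNReal.ofReal (2 / Real.pi) := by
    rintro p ⟨hp, -⟩
    have hp0 : 0 < p.1 := hp
    rw [Complex.norm_polarCoord_symm, abs_of_pos hp0, smul_eq_mul, ← ENNReal.ofReal_mul hp0.le,
      ← ENNReal.ofReal_mul (by positivity)]
    congr 1
    ring
  rw [Measure.prod_restrict,
    setLIntegral_congr_fun (measurableSet_Ioi.prod measurableSet_Ioo) hpt, ← Measure.prod_restrict,
    lintegral_prod_mul (f := fun r : ℝ =>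
      ENNReal.ofReal (r * (|4 * r ^ 2 - 1| * Real.exp (-2 * r ^ 2))))
      (g := fun _ : ℝ => ENNReal.ofReal (2 / Real.pi)) (by fun_prop) (by fun_prop),
    lintegral_one_photon_radial, lintegral_const, Measure.restrict_apply_univ, Real.volume_Ioo,
    ← ENNReal.ofReal_mul (by positivity), ← ENNReal.ofReal_mul (by linarith)]
  congr 1
  rw [← Real.exp_half, Real.exp_neg]
  field_simp
  ring

lemma diagVolume_wState (M : ℕ) [NeZero M] :
    diagVolume (pureState (wState M)) =
      ENNReal.ofReal (4 / (M * Real.sqrt (Real.exp 1)) - 1 / M) := by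
  obtain ⟨L, hL, hcol⟩ := exists_balanced_log M
  rw [← interfere_ket_one hL hcol,
    diagVolume_interfere hL hcol (isState_pureState (norm_ket _)), lintegral_wigner_one_photon,
    ← ENNReal.ofReal_mul (by positivity)]
  congr 1
  field_simp

/-! ### The entanglement criterion -/

/-- Squaring gives M² < 4K²(M − 1) with 4K² ≈ 8.135. The close case is M = 7, where 49 exceeds
48.82; hence the four-digit bounds on √e. -/
lemma one_div_two_sqrt_lt_iff {M : ℕ} (hM : 2 ≤ M) :
    1 / (2 * Real.sqrt ((M : ℝ) - 1)) < 4 / (M * Real.sqrt (Real.exp 1)) - 1 / M ↔ M ≤ 6 := by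
  have hM' : (2 : ℝ) ≤ M := by exact_mod_cast hM
  set s := Real.sqrt ((M : ℝ) - 1) with hs
  have hs0 : 0 < s := Real.sqrt_pos.mpr (by linarith)
  have hss : s ^ 2 = M - 1 := Real.sq_sqrt (by linarith)
  set q := Real.sqrt (Real.exp 1) with hq
  have hqq : q ^ 2 = Real.exp 1 := Real.sq_sqrt (Real.exp_pos 1).le
  have hq0 : 0 < q := Real.sqrt_pos.mpr (Real.exp_pos 1)
  have he1 := Real.exp_one_gt_d9
  have he2 := Real.exp_one_lt_d9
  have hq1 : 1.6487 < q := by nlinarith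
  have hq2 : q < 1.6488 := by nlinarith
  have hK1 : 1.426 < 4 / q - 1 := by
    rw [lt_sub_iff_add_lt, lt_div_iff₀ hq0]; nlinarith
  have hK2 : 4 / q - 1 < 1.4262 := by
    rw [sub_lt_iff_lt_add, div_lt_iff₀ hq0]; nlinarith
  set K := 4 / q - 1 with hK
  have hrw : 4 / (M * q) - 1 / M = K / M := by
    rw [hK]; field_simp
  rw [hrw, div_lt_div_iff₀ (by positivity) (by linarith), one_mul]
  have hsq : (M : ℝ) < K * (2 * s) ↔ (M : ℝ) ^ 2 < 4 * K ^ 2 * (M - 1) := by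
    rw [← hss, show 4 * K ^ 2 * s ^ 2 = (K * (2 * s)) ^ 2 by ring]
    exact (pow_lt_pow_iff_left₀ (by linarith) (by positivity) two_ne_zero).symm
  rw [hsq]
  constructor
  · intro h
    by_contra! h7
    have h7' : (7 : ℝ) ≤ M := by exact_mod_cast h7
    have hKK : K ^ 2 < 2.0341 := by nlinarith
    nlinarith
  · intro h6
    have hKK : 2.0334 < K ^ 2 := by nlinarith
    interval_cases M <;> push_cast <;> linarith

end BosonicModes

open BosonicModes
theorem mainTheorem5 :
    (∀ (M : ℕ) [NeZero M] (𝒰 : Matrix.unitaryGroup (Fin M) ℂ) (U : Fock M →L[ℂ] Fock M)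
        (c : Fin M → Fin M → ℂ),
      IsMultiportBeamsplitter 𝒰 U → IsBalanced U c →
        (∀ ρ₁ : Fock 1 →L[ℂ] Fock 1, IsState ρ₁ →
          diagVolume (interfere U ρ₁) =
            ENNReal.ofReal (1 / M) * ∫⁻ α : ℂ, ‖wigner ρ₁ (fun _ => α)‖ₑ) ∧
        interfere U (pureState (ket fun _ => 1)) = pureState (wState M)) ∧
    (∀ M : ℕ, 1 ≤ M →
      diagVolume (pureState (wState M)) =
        ENNReal.ofReal (4 / (M * Real.sqrt (Real.exp 1)) - 1 / M)) ∧
    (∀ M : ℕ, 2 ≤ M →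
      (ENNReal.ofReal (1 / (2 * Real.sqrt ((M : ℝ) - 1))) < diagVolume (pureState (wState M)) ↔
        M ≤ 6)) := by
  refine ⟨?_, fun M hM => ?_, fun M hM => ?_⟩
  · rintro M _ 𝒰 U c ⟨L, hL, -, rfl⟩ hbal
    exact ⟨fun ρ₁ hρ => diagVolume_interfere hL hbal.exp_apply_zero hρ,
      interfere_ket_one hL hbal.exp_apply_zero⟩
  · have : NeZero M := ⟨by omega⟩
    exact diagVolume_wState M
  · have : NeZero M := ⟨by omega⟩
    have hM' : (2 : ℝ) ≤ M := by exact_mod_cast hM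
    have hpos : 0 < 1 / (2 * Real.sqrt ((M : ℝ) - 1)) := by
      have := Real.sqrt_pos.mpr (by linarith : (0 : ℝ) < M - 1)
      positivity
    -- Only the left argument must be nonnegative: a negative right one would be truncated to 0 and
    -- make both inequalities fail.
    rw [diagVolume_wState, ENNReal.ofReal_lt_ofReal_iff_of_nonneg hpos.le,
      one_div_two_sqrt_lt_iff hM]
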